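/- Setup. Let $b_1,b_2,\dots$ be positive integers and $A_n\subseteq\{0,1,\dots,b_n\}$. The $(\{b_n\},\{A_n\},0)$-sequence is an infinite list of positive integers cut into consecutive bins, the $n$-th bin ($n\ge1$) consisting of $b_n$ terms. A finite choice of (positions of) terms is legal if, for every $n$, the number of terms chosen from bin $n$ lies in $A_n$ (there is no adjacency condition). The first term is $1$, and each further term is the least positive integer that is not the sum of a legal choice of the terms constructed so far. A legal decomposition of $x$ is a legal choice of terms with sum $x$. Theorem. Let $b_n=n$ and, for every $n\ge1$, $A_n\in\{\{0,\dots,n-1\},\{0,\dots,n\}\}$ (the choice may vary with $n$). Then: 1. Every positive integer has exactly one legal decomposition, so the number $Y_n(x)$ of summands of $x$ from bin $n$ and the total number $Y(x)$ of summands of $x$ are well defined. 2. If $x$ is uniformly distributed on the nonnegative integers that are generated by the bins $1,\dots,N$, then $Y_1(x),\dots,Y_N(x)$ are independent, and $Y_n(x)=i$ with the probability $p_n(i)$ that a uniformly random choice of terms from bin $n$, among those whose size lies in $A_n$, has size $i$. 3. Let $Y_1,Y_2,\dots$ be independent random variables with $P(Y_n=i)=p_n(i)$, $\mu_n=\mathbb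 E[Y_n]$, $\sigma_n^2=\operatorname{Var}(Y_n)$ and $s_N^2=\sum_{n=1}^N\sigma_n^2$. Then for every integer $\delta>0$ the moments $\mathbb E[|Y_n|^{2+\delta}]$ are finite and Lyapunov's condition $$\lim_{N\to\infty}\frac1{s_N^{2+\delta}}\sum_{n=1}^N\mathbb E\big[|Y_n-\mu_n|^{2+\delta}\big]=0$$ holds, and $\frac1{s_N}\sum_{n=1}^N(Y_n-\mu_n)$ converges in distribution to the standard normal as $N\to\infty$. 4. If $x$ is uniformly distributed on the integers whose largest summand is in bin $N$, then $Y(x)$, centered by its mean and divided by its standard deviation, converges in distribution to the standard normal as $N\to\infty$. -/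

import Mathlib

open MeasureTheory ProbabilityTheory Filter Topology Finset

namespace BinSeq

/-- The terms of the sequence are listed in order and indexed by their positions `0, 1, 2, …`.
Bins are numbered `1, 2, 3, …`; this is the position of the first term of bin `n`. -/
def binStart (b : ℕ → ℕ) (n : ℕ) : ℕ := ∑ j ∈ Ico 1 n, b j

/-- The `b n` positions that form bin `n` (for `n ≥ 1`). -/
def bin (b : ℕ → ℕ) (n : ℕ) : Finset ℕ := Ico (binStart b n) (binStart b (n + 1))

/-- A finite set of positions is legal if the number of positions chosen in each bin `n` lies in
`A n`, and any two different bins that are used have at least `a` bins between them. -/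
def IsLegal (b : ℕ → ℕ) (A : ℕ → Finset ℕ) (a : ℕ) (S : Finset ℕ) : Prop :=
  (∀ n, 1 ≤ n → #(S ∩ bin b n) ∈ A n) ∧
  ∀ m n, 1 ≤ m → m < n → (S ∩ bin b m).Nonempty → (S ∩ bin b n).Nonempty → m + a < n

/-- The `({b_n}, {A_n}, a)`-sequence: the first term is `1`, and each further term is the least
positive integer that is not the sum of a legal choice of the terms constructed so far. -/
noncomputable def seq (b : ℕ → ℕ) (A : ℕ → Finset ℕ) (a : ℕ) : ℕ → ℕ
  | 0 => 1
  | k + 1 => sInf {m : ℕ | 0 < m ∧ ¬ ∃ S : Finset (Fin (k + 1)),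
      IsLegal b A a (S.map Fin.valEmbedding) ∧ ∑ i ∈ S, seq b A a i = m}
decreasing_by exact i.2

/-- `S` is (the set of positions of the summands of) a legal decomposition of `x`. -/
def IsDecomposition (b : ℕ → ℕ) (A : ℕ → Finset ℕ) (a : ℕ) (S : Finset ℕ) (x : ℕ) : Prop :=
  IsLegal b A a S ∧ ∑ i ∈ S, seq b A a i = x

open Classical in
/-- The legal decomposition of `x`. It is meaningful when `x` has exactly one. -/
noncomputable def decomp (b : ℕ → ℕ) (A : ℕ → Finset ℕ) (a : ℕ) (x : ℕ) : Finset ℕ :=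
  if h : ∃ S, IsDecomposition b A a S x then h.choose else ∅

/-- The number of summands from bin `n` in the decomposition of `x`. -/
noncomputable def binCount (b : ℕ → ℕ) (A : ℕ → Finset ℕ) (a n x : ℕ) : ℕ :=
  #(decomp b A a x ∩ bin b n)

/-- The number of summands in the decomposition of `x`. -/
noncomputable def numSummands (b : ℕ → ℕ) (A : ℕ → Finset ℕ) (a x : ℕ) : ℕ :=
  #(decomp b A a x)

/-- The nonnegative integers that have a legal decomposition using only the bins `1, …, N`. -/
def generatedBy (b : ℕ → ℕ) (A : ℕ → Finset ℕ) (a N : ℕ) : Set ℕ :=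
  {x | ∃ S, IsDecomposition b A a S x ∧ ∀ i ∈ S, i < binStart b (N + 1)}

/-- The integers whose largest summand is in bin `N`. -/
def largestInBin (b : ℕ → ℕ) (A : ℕ → Finset ℕ) (a N : ℕ) : Set ℕ :=
  {x | ∃ i ∈ decomp b A a x, i ∈ bin b N ∧ ∀ j ∈ decomp b A a x, seq b A a j ≤ seq b A a i}

/-- The allowed choices of terms from bin `n`. -/
def choices (b : ℕ → ℕ) (A : ℕ → Finset ℕ) (n : ℕ) : Finset (Finset ℕ) :=
  {S ∈ (bin b n).powerset | #S ∈ A n}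

/-- The probability that a uniformly random allowed choice from bin `n` has exactly `i` terms. -/
noncomputable def countProb (b : ℕ → ℕ) (A : ℕ → Finset ℕ) (n i : ℕ) : ℝ :=
  (#{S ∈ choices b A n | #S = i} : ℝ) / #(choices b A n)

/-- The standard deviation `s_N` of `Y_1 + ⋯ + Y_N` for independent `Y_n`, i.e. the square root of
the sum of the variances. -/
noncomputable def sd {Ω : Type*} [MeasurableSpace Ω] (P : Measure Ω) (Y : ℕ → Ω → ℝ) (N : ℕ) : ℝ :=
  √(∑ n ∈ Icc 1 N, Var[Y n; P])

/-- Lyapunov's condition with exponent `2 + δ` for the random variables `Y_1, Y_2, …`, including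
finiteness of the moments involved. -/
def LyapunovCondition {Ω : Type*} [MeasurableSpace Ω] (P : Measure Ω) (Y : ℕ → Ω → ℝ) (δ : ℕ) :
    Prop :=
  (∀ n, 1 ≤ n → MemLp (Y n) (2 + δ) P) ∧
  Tendsto (fun N : ℕ => (1 / sd P Y N ^ (2 + δ)) *
    ∑ n ∈ Icc 1 N, ∫ ω, |Y n ω - ∫ ω', Y n ω' ∂P| ^ (2 + δ) ∂P) atTop (𝓝 0)

end BinSeq

/-! ### Lyapunov's central limit theorem for triangular arrays -/

/-! Let c_n be the number of allowed choices from bin n, so c_n is 2^n or 2^n - 1, and let M_N = c_1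
⋯ c_N (`totalChoices`). The sequence is a mixed radix numeral system: the i-th term of bin n + 1,
counting from 0, is M_n 2^i. A choice of terms from a bin is then the binary expansion of a digit.
The only choice that can be forbidden, the full bin, has the largest value, so the allowed choices
are exactly those whose digit is below c_n (`card_mem_allowed_iff`). Hence legal choices from the
bins 1, …, N correspond to the integers below M_N (`sum_lt_totalChoices`, `eq_of_sum_eq`,
`exists_isLegal_sum_eq`). The greedy rule produces these weights because the terms preceding M_n 2^i
represent precisely the integers below it (`isMixedRadix_seq`).

This bijection has product form, so a uniform integer below M_N amounts to independent uniform
choices from the bins (`sum_prod_decomp`, `iIndepFun_binCount`). The same holds for the integers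
with largest summand in bin N ≥ 2, where the choice from bin N must also be nonempty
(`largestInBin_eq`).

Every family of choices that occurs lacks at most two subsets of its bin. The counts therefore
behave like binomial(n, 1/2) variables: the variance is at least n/4 - 2 and the k-th central moment
is O(n^(k/2)). So s_N ≥ N/4 for large N, and Lyapunov's ratio with exponent k ≥ 3 is O(N^(-1/2))
(`lyapunov_ratio_le`). The limit theorem follows from the case k = 3 by characteristic functions. It
is proved for triangular arrays, since the uniform measures change with N. -/

lemma norm_prod_sub_prod_le_sum {ι : Type*} (s : Finset ι) (z w : ι → ℂ)
    (hz : ∀ i ∈ s, ‖z i‖ ≤ 1) (hw : ∀ i ∈ s, ‖w i‖ ≤ 1) :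
    ‖∏ i ∈ s, z i - ∏ i ∈ s, w i‖ ≤ ∑ i ∈ s, ‖z i - w i‖ := by
  classical
  induction s using Finset.induction with
  | empty => simp
  | insert a s ha ih =>
    rw [Finset.prod_insert ha, Finset.prod_insert ha, Finset.sum_insert ha]
    have hih := ih (fun i hi => hz i (mem_insert_of_mem hi)) (fun i hi => hw i (mem_insert_of_mem hi))
    have hp : ‖∏ i ∈ s, z i‖ ≤ 1 := by
      rw [norm_prod]
      exact Finset.prod_le_one (fun _ _ => norm_nonneg _) fun i hi => hz i (mem_insert_of_mem hi)
    calc ‖z a * ∏ i ∈ s, z i - w a * ∏ i ∈ s, w i‖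
        = ‖(z a - w a) * ∏ i ∈ s, z i + w a * (∏ i ∈ s, z i - ∏ i ∈ s, w i)‖ := by congr 1; ring
      _ ≤ ‖z a - w a‖ * ‖∏ i ∈ s, z i‖ + ‖w a‖ * ‖∏ i ∈ s, z i - ∏ i ∈ s, w i‖ := by
        refine (norm_add_le _ _).trans ?_
        rw [norm_mul, norm_mul]
      _ ≤ ‖z a - w a‖ * 1 + 1 * ‖∏ i ∈ s, z i - ∏ i ∈ s, w i‖ := by
        gcongr
        exact hw a (mem_insert_self _ _)
      _ ≤ _ := by linarith

/-- Taylor's bound serves for |x| ≤ 1. For |x| ≥ 1 the triangle inequality gives 2 + |x| + |x|²/2 ≤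
4|x|³. -/
lemma norm_exp_I_mul_sub_quadratic_le (x : ℝ) :
    ‖Complex.exp (x * Complex.I) - (1 + x * Complex.I - x ^ 2 / 2)‖ ≤ 4 * |x| ^ 3 := by
  have hn : ‖(x * Complex.I : ℂ)‖ = |x| := by simp
  rcases le_total |x| 1 with h | h
  · have := Complex.exp_bound (x := x * Complex.I) (by rwa [hn]) (n := 3) (by norm_num)
    rw [hn] at this
    have e : ∑ m ∈ range 3, (x * Complex.I : ℂ) ^ m / (m.factorial : ℂ) =
        1 + x * Complex.I - x ^ 2 / 2 := by
      simp [Finset.sum_range_succ, Nat.factorial, mul_pow]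
      ring
    rw [e] at this
    refine this.trans ?_
    rw [mul_comm]
    gcongr
    norm_num [Nat.factorial]
  · have h1 : ‖Complex.exp (x * Complex.I)‖ = 1 := Complex.norm_exp_ofReal_mul_I x
    have h2 : ‖(x ^ 2 / 2 : ℂ)‖ = |x| ^ 2 / 2 := by simp
    calc _ ≤ ‖Complex.exp (x * Complex.I)‖ + (‖(1 : ℂ)‖ + ‖(x * Complex.I : ℂ)‖ + ‖(x ^ 2 / 2 : ℂ)‖) := by
          refine (norm_sub_le _ _).trans ?_
          gcongr
          refine (norm_sub_le _ _).trans ?_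
          gcongr
          exact norm_add_le _ _
      _ = 2 + |x| + |x| ^ 2 / 2 := by rw [h1, hn, h2, norm_one]; ring
      _ ≤ _ := by
        have h3 : |x| ≤ |x| ^ 3 := by nlinarith [mul_self_nonneg (|x| - 1), sq_nonneg |x|]
        have h4 : |x| ^ 2 ≤ |x| ^ 3 := pow_le_pow_right₀ h (by norm_num)
        linarith

lemma abs_exp_neg_sub_le (y : ℝ) (hy : 0 ≤ y) : |Real.exp (-y) - (1 - y)| ≤ y ^ 2 := by
  rcases le_total y 1 with h | h
  · have := Real.abs_exp_sub_one_sub_id_le (x := -y) (by rw [abs_neg, abs_of_nonneg hy]; exact h)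
    rw [neg_sq] at this
    convert this using 2
    ring
  · rw [abs_le]
    have h1 : Real.exp (-y) ≤ 1 := Real.exp_le_one_iff.2 (by linarith)
    have h2 := Real.exp_pos (-y)
    constructor <;> nlinarith

lemma integrable_abs_cube {Ω : Type*} {m : MeasurableSpace Ω} {P : Measure Ω} {X : Ω → ℝ}
    (hX : MemLp X 3 P) : Integrable (fun ω => |X ω| ^ 3) P := by
  simpa using hX.integrable_norm_pow (p := 3) (by norm_num)

/-! ### Third moments and the expansion of characteristic functions -/

section Moments

variable {Ω : Type*} {m : MeasurableSpace Ω} {P : Measure Ω} [IsProbabilityMeasure P] {X : Ω → ℝ}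

/-- The second and third absolute moments satisfy `(E X²)^(3/2) ≤ E |X|³`. -/
lemma sqrt_second_moment_pow_three_le (hX : MemLp X 3 P) :
    √(∫ ω, X ω ^ 2 ∂P) ^ 3 ≤ ∫ ω, |X ω| ^ 3 ∂P := by
  have hX2 : Integrable (fun ω => X ω ^ 2) P :=
    (hX.mono_exponent (by norm_num : (2 : ENNReal) ≤ 3)).integrable_sq
  have hX3 := integrable_abs_cube hX
  set s := √(∫ ω, X ω ^ 2 ∂P) with hs
  have hs0 : 0 ≤ s := Real.sqrt_nonneg _
  have hs2 : s ^ 2 = ∫ ω, X ω ^ 2 ∂P := Real.sq_sqrt (integral_nonneg fun _ => sq_nonneg _)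
  -- Integrated form of (x - s)²(2x + s) ≥ 0 with x = |X ω|; since E X² = s², it yields 3s³ ≤ 2
  -- E|X|³ + s³.
  have key : ∫ ω, 3 * s * X ω ^ 2 ∂P ≤ ∫ ω, (2 * |X ω| ^ 3 + s ^ 3) ∂P := by
    refine integral_mono (hX2.const_mul _) ((hX3.const_mul _).add (integrable_const _)) fun ω => ?_
    have h0 := abs_nonneg (X ω)
    rw [← sq_abs (X ω)]
    nlinarith [mul_nonneg (sq_nonneg (|X ω| - s)) (by positivity : 0 ≤ 2 * |X ω| + s)]
  rw [integral_const_mul, integral_add (hX3.const_mul _) (integrable_const _),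
    integral_const_mul, ← hs2] at key
  simp at key
  nlinarith

lemma norm_charFun_sub_quadratic_le (hX : MemLp X 3 P) (h0 : ∫ ω, X ω ∂P = 0) (t : ℝ) :
    ‖charFun (P.map X) t - ((1 - t ^ 2 * (∫ ω, X ω ^ 2 ∂P) / 2 : ℝ) : ℂ)‖ ≤
      4 * |t| ^ 3 * ∫ ω, |X ω| ^ 3 ∂P := by
  have hm : AEMeasurable X P := hX.aestronglyMeasurable.aemeasurable
  have hX1 : Integrable X P := hX.integrable (by norm_num)
  have hX2 : Integrable (fun ω => X ω ^ 2) P :=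
    (hX.mono_exponent (by norm_num : (2 : ENNReal) ≤ 3)).integrable_sq
  have hX3 := integrable_abs_cube hX
  have hexp : Integrable (fun ω => Complex.exp (((t * X ω : ℝ) : ℂ) * Complex.I)) P := by
    refine Integrable.of_bound (C := 1) ?_ (ae_of_all _ fun ω => ?_)
    · exact AEMeasurable.aestronglyMeasurable (by fun_prop)
    · exact (Complex.norm_exp_ofReal_mul_I _).le
  have hq : Integrable (fun ω => (1 + ((t * X ω : ℝ) : ℂ) * Complex.I
      - ((t * X ω : ℝ) : ℂ) ^ 2 / 2)) P := by
    refine ((integrable_const _).add ((hX1.const_mul t).ofReal.mul_const _)).sub ?_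
    have : Integrable (fun ω => ((t ^ 2 * X ω ^ 2 : ℝ) : ℂ)) P := (hX2.const_mul (t ^ 2)).ofReal
    convert this.div_const 2 using 2
    push_cast
    ring
  have hqi : ∫ ω, (1 + ((t * X ω : ℝ) : ℂ) * Complex.I - ((t * X ω : ℝ) : ℂ) ^ 2 / 2) ∂P =
      ((1 - t ^ 2 * (∫ ω, X ω ^ 2 ∂P) / 2 : ℝ) : ℂ) := by
    have e : ∀ ω, (1 + ((t * X ω : ℝ) : ℂ) * Complex.I - ((t * X ω : ℝ) : ℂ) ^ 2 / 2) =
        (1 + ((t * X ω : ℝ) : ℂ) * Complex.I) - ((t ^ 2 / 2 * X ω ^ 2 : ℝ) : ℂ) := by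
      intro ω; push_cast; ring
    simp_rw [e]
    rw [integral_sub ((integrable_const _).add ((hX1.const_mul t).ofReal.mul_const _))
      (hX2.const_mul _).ofReal, integral_add (integrable_const _)
      ((hX1.const_mul t).ofReal.mul_const _), integral_mul_const, integral_complex_ofReal,
      integral_complex_ofReal, integral_const_mul, integral_const_mul, h0]
    simp
    ring
  have hc : charFun (P.map X) t = ∫ ω, Complex.exp (((t * X ω : ℝ) : ℂ) * Complex.I) ∂P := by
    rw [charFun_apply_real, integral_map hm (AEMeasurable.aestronglyMeasurable (by fun_prop))]
    simp
  rw [hc, ← hqi, ← integral_sub hexp hq, ← integral_const_mul]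
  refine norm_integral_le_of_norm_le (hX3.const_mul _) (ae_of_all _ fun ω => ?_)
  refine (norm_exp_I_mul_sub_quadratic_le (t * X ω)).trans_eq ?_
  rw [abs_mul]; ring

end Moments

/-! ### Comparison with the Gaussian along a triangular array -/

section Array

variable {Ω ι : ℕ → Type*} [∀ N, Fintype (ι N)] {m : ∀ N, MeasurableSpace (Ω N)}
  {P : ∀ N, Measure (Ω N)} [∀ N, IsProbabilityMeasure (P N)]

/-- Since the variances v add up to 1, the Gaussian transform splits into factors exp(-t²v/2). These
and the characteristic functions are compared factor by factor through 1 - t²v/2. -/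
lemma norm_prod_charFun_sub_exp_le {Ω ι : Type*} [Fintype ι] {m : MeasurableSpace Ω}
    {P : Measure Ω} [IsProbabilityMeasure P] {X : ι → Ω → ℝ} (hX : ∀ i, MemLp (X i) 3 P)
    (h0 : ∀ i, ∫ ω, X i ω ∂P = 0) (h2 : ∑ i, ∫ ω, X i ω ^ 2 ∂P = 1) (t : ℝ) :
    ‖∏ i, charFun (P.map (X i)) t - Complex.exp (-(t ^ 2 / 2))‖ ≤
      (4 * |t| ^ 3 + t ^ 4) * ∑ i, ∫ ω, |X i ω| ^ 3 ∂P := by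
  have hnn : ∀ i, 0 ≤ ∫ ω, X i ω ^ 2 ∂P := fun i => integral_nonneg fun _ => sq_nonneg _
  have hexp : Complex.exp (-(t ^ 2 / 2)) =
      ∏ i, ((Real.exp (-(t ^ 2 * (∫ ω, X i ω ^ 2 ∂P) / 2)) : ℝ) : ℂ) := by
    rw [← Complex.ofReal_prod, ← Real.exp_sum, Finset.sum_neg_distrib, ← Finset.sum_div,
      ← Finset.mul_sum, h2]
    push_cast
    simp
  rw [hexp, Finset.mul_sum]
  refine (norm_prod_sub_prod_le_sum _ _ _ (fun i _ => ?_) fun i _ => ?_).trans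
    (Finset.sum_le_sum fun i _ => ?_)
  · have : IsProbabilityMeasure (P.map (X i)) :=
      Measure.isProbabilityMeasure_map (hX i).aestronglyMeasurable.aemeasurable
    exact norm_charFun_le_one t
  · rw [Complex.norm_real, Real.norm_of_nonneg (Real.exp_pos _).le]
    refine Real.exp_le_one_iff.2 ?_
    have := hnn i
    simp only [Left.neg_nonpos_iff]
    positivity
  · set v := ∫ ω, X i ω ^ 2 ∂P with hv
    have hv1 : v ≤ 1 := h2 ▸ Finset.single_le_sum (f := fun i => ∫ ω, X i ω ^ 2 ∂P)
      (fun j _ => hnn j) (Finset.mem_univ i)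
    -- As v ≤ 1, v² ≤ v^(3/2) ≤ E|X|³, so the third moment also absorbs the error of the Gaussian
    -- factor.
    have hv3 : v ^ 2 ≤ ∫ ω, |X i ω| ^ 3 ∂P := by
      refine le_trans ?_ (sqrt_second_moment_pow_three_le (hX i))
      rw [← hv]
      have h1 : √v ≤ 1 := Real.sqrt_le_one.2 hv1
      have h2 : v = √v ^ 2 := (Real.sq_sqrt (hnn i)).symm
      calc v ^ 2 = √v ^ 4 := by rw [h2]; simp; ring
        _ ≤ √v ^ 3 := pow_le_pow_of_le_one (Real.sqrt_nonneg _) h1 (by norm_num)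
    have e1 := norm_charFun_sub_quadratic_le (hX i) (h0 i) t
    rw [← hv] at e1
    have e2 : ‖((1 - t ^ 2 * v / 2 : ℝ) : ℂ) - (Real.exp (-(t ^ 2 * v / 2)) : ℝ)‖ ≤ t ^ 4 * v ^ 2 := by
      rw [← Complex.ofReal_sub, Complex.norm_real, Real.norm_eq_abs, abs_sub_comm]
      refine (abs_exp_neg_sub_le _ (by have := hnn i; positivity)).trans ?_
      nlinarith [sq_nonneg (t ^ 2 * v)]
    have e3 := norm_sub_le_norm_sub_add_norm_sub (charFun (P.map (X i)) t)
      ((1 - t ^ 2 * v / 2 : ℝ) : ℂ) ((Real.exp (-(t ^ 2 * v / 2)) : ℝ) : ℂ)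
    have e4 : t ^ 4 * v ^ 2 ≤ t ^ 4 * ∫ ω, |X i ω| ^ 3 ∂P := by gcongr
    linarith

/-- **Lyapunov's central limit theorem** (with third moments) for a triangular array of centered
variables, each row of which is independent and has total variance `1`. -/
theorem tendstoInDistribution_sum_of_normalized {X : ∀ N, ι N → Ω N → ℝ}
    (hX : ∀ N i, MemLp (X N i) 3 (P N)) (hind : ∀ N, iIndepFun (X N) (P N))
    (h0 : ∀ N i, ∫ ω, X N i ω ∂P N = 0) (h2 : ∀ᶠ N in atTop, ∑ i, ∫ ω, X N i ω ^ 2 ∂P N = 1)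
    (h3 : Tendsto (fun N => ∑ i, ∫ ω, |X N i ω| ^ 3 ∂P N) atTop (𝓝 0)) :
    TendstoInDistribution (fun N ω => ∑ i, X N i ω) atTop (id : ℝ → ℝ) P (gaussianReal 0 1) where
  forall_aemeasurable N := Finset.aemeasurable_fun_sum _ fun i _ =>
    (hX N i).aestronglyMeasurable.aemeasurable
  tendsto := by
    refine ProbabilityMeasure.tendsto_iff_tendsto_charFun.2 fun t => ?_
    simp only [ProbabilityMeasure.coe_mk, Measure.map_id, charFun_gaussianReal]
    rw [tendsto_iff_norm_sub_tendsto_zero]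
    have hlim := h3.const_mul (4 * |t| ^ 3 + t ^ 4)
    rw [mul_zero] at hlim
    refine squeeze_zero' (Eventually.of_forall fun _ => norm_nonneg _) ?_ hlim
    filter_upwards [h2] with N hN
    rw [(hind N).charFun_map_fun_sum_eq_prod fun i => (hX N i).aestronglyMeasurable.aemeasurable,
      Finset.prod_apply]
    have e : (t * ((0 : ℝ) : ℂ) * Complex.I - (((1 : NNReal) : ℝ) : ℂ) * t ^ 2 / 2) =
        -(t ^ 2 / 2 : ℂ) := by simp
    rw [e]
    exact norm_prod_charFun_sub_exp_le (hX N) (h0 N) hN t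

/-- **Lyapunov's central limit theorem** (with third moments) for a triangular array whose rows are
independent. -/
theorem tendstoInDistribution_sum_of_lyapunov {Y : ∀ N, ι N → Ω N → ℝ}
    (hY : ∀ N i, MemLp (Y N i) 3 (P N)) (hind : ∀ N, iIndepFun (Y N) (P N))
    (hpos : ∀ᶠ N in atTop, 0 < ∑ i, Var[Y N i; P N])
    (h3 : Tendsto (fun N => (1 / √(∑ i, Var[Y N i; P N]) ^ 3) *
      ∑ i, ∫ ω, |Y N i ω - ∫ ω', Y N i ω' ∂P N| ^ 3 ∂P N) atTop (𝓝 0)) :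
    TendstoInDistribution (fun N ω => (1 / √(∑ i, Var[Y N i; P N])) *
      ∑ i, (Y N i ω - ∫ ω', Y N i ω' ∂P N)) atTop (id : ℝ → ℝ) P (gaussianReal 0 1) := by
  simp_rw [Finset.mul_sum]
  have hm : ∀ N i, MemLp (fun ω => Y N i ω - ∫ ω', Y N i ω' ∂P N) 3 (P N) := fun N i =>
    (hY N i).sub (memLp_const _)
  refine tendstoInDistribution_sum_of_normalized (fun N i => (hm N i).const_mul _) (fun N => ?_)
    (fun N i => ?_) ?_ ?_
  · exact (hind N).comp (fun i x => 1 / √(∑ i, Var[Y N i; P N]) * (x - ∫ ω', Y N i ω' ∂P N))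
      fun i => by fun_prop
  · rw [integral_const_mul, integral_sub ((hY N i).integrable (by norm_num)) (integrable_const _)]
    simp
  · filter_upwards [hpos] with N hN
    simp_rw [mul_pow, integral_const_mul, ← Finset.mul_sum]
    have e : ∀ i, ∫ ω, (Y N i ω - ∫ ω', Y N i ω' ∂P N) ^ 2 ∂P N = Var[Y N i; P N] := fun i =>
      (variance_eq_integral (hY N i).aestronglyMeasurable.aemeasurable).symm
    simp_rw [e, div_pow, Real.sq_sqrt hN.le, one_pow]
    exact one_div_mul_cancel hN.ne'
  · refine h3.congr fun N => ?_
    rw [Finset.mul_sum]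
    refine Finset.sum_congr rfl fun i _ => ?_
    rw [← integral_const_mul]
    congr 1 with ω
    rw [abs_mul, mul_pow, abs_of_nonneg (a := 1 / √_) (by positivity), div_pow, one_pow]

end Array

/-- Convergence in distribution to a standard normal gives pointwise convergence of the
distribution functions. -/
lemma tendsto_measureReal_le_of_tendstoInDistribution_gaussian {Ω : ℕ → Type*}
    {m : ∀ N, MeasurableSpace (Ω N)} {P : ∀ N, Measure (Ω N)} [∀ N, IsProbabilityMeasure (P N)]
    {X : ∀ N, Ω N → ℝ}
    (h : TendstoInDistribution X atTop (id : ℝ → ℝ) P (gaussianReal 0 1)) (t : ℝ) :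
    Tendsto (fun N => (P N).real {ω | X N ω ≤ t}) atTop (𝓝 (cdf (gaussianReal 0 1) t)) := by
  have : NullSingletonClass (gaussianReal 0 1) := nullSingletonClass_gaussianReal one_ne_zero
  have key := ProbabilityMeasure.tendsto_measure_of_null_frontier_of_tendsto' h.tendsto
    (E := Set.Iic t) (by simp [measure_singleton])
  simp only [ProbabilityMeasure.coe_mk, Measure.map_id] at key
  rw [cdf_eq_real]
  refine ((ENNReal.tendsto_toReal (measure_ne_top _ _)).comp key).congr fun N => ?_
  rw [Function.comp_apply, Measure.map_apply_of_aemeasurable (h.forall_aemeasurable N)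
    measurableSet_Iic]
  rfl

/-! ### The sequence whose `n`-th bin has `n` terms -/

lemma exists_subset_range_sum_two_pow {n y : ℕ} (hy : y < 2 ^ n) :
    ∃ T ⊆ range n, ∑ i ∈ T, 2 ^ i = y := by
  refine ⟨y.bitIndices.toFinset, fun i hi => ?_, Finset.sum_toFinset_bitIndices_two_pow y⟩
  have := Nat.two_pow_le_of_mem_bitIndices (List.mem_toFinset.1 hi)
  exact mem_range.2 ((Nat.pow_lt_pow_iff_right (by norm_num)).1 (this.trans_lt hy))

lemma sum_two_pow_lt_of_subset_range {n : ℕ} {T : Finset ℕ} (hT : T ⊆ range n) :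
    ∑ i ∈ T, 2 ^ i < 2 ^ n :=
  Nat.geomSum_lt le_rfl fun _ hk => mem_range.1 (hT hk)

lemma sum_two_pow_range (n : ℕ) : ∑ i ∈ range n, 2 ^ i = 2 ^ n - 1 := by
  simpa using Nat.geomSum_eq le_rfl n

namespace BinSeq

/-- Bin `n` has `n` terms, of which any number may be chosen, or any number but all of them. -/
structure IsLinear (b : ℕ → ℕ) (A : ℕ → Finset ℕ) : Prop where
  size : ∀ n, 1 ≤ n → b n = n
  allowed : ∀ n, 1 ≤ n → A n = range n ∨ A n = range (n + 1)

/-- The number of allowed choices of terms from the bins `1, …, N`. -/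
def totalChoices (b : ℕ → ℕ) (A : ℕ → Finset ℕ) (N : ℕ) : ℕ := ∏ n ∈ Icc 1 N, #(choices b A n)

/-- The indices, within bin `n + 1`, of the positions in `S`. -/
def digits (b : ℕ → ℕ) (n : ℕ) (S : Finset ℕ) : Finset ℕ :=
  {j ∈ range (n + 1) | binStart b (n + 1) + j ∈ S}

variable {b : ℕ → ℕ} {A : ℕ → Finset ℕ}

lemma totalChoices_succ (N : ℕ) :
    totalChoices b A (N + 1) = totalChoices b A N * #(choices b A (N + 1)) :=
  prod_Icc_succ_top (by omega) _

lemma binStart_one : binStart b 1 = 0 := by simp [binStart]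

lemma binStart_mono : Monotone (binStart b) := fun _ _ h =>
  sum_le_sum_of_subset (Ico_subset_Ico_right h)

lemma bin_disjoint {m n : ℕ} (h : m ≠ n) : Disjoint (bin b m) (bin b n) := by
  wlog hmn : m < n generalizing m n
  · exact (this h.symm (by omega)).symm
  · rw [Finset.disjoint_left]
    intro k hk hk'
    have : binStart b (m + 1) ≤ binStart b n := binStart_mono hmn
    simp only [bin, mem_Ico] at hk hk'
    omega

lemma isLegal_zero_iff {S : Finset ℕ} :
    IsLegal b A 0 S ↔ ∀ n, 1 ≤ n → #(S ∩ bin b n) ∈ A n :=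
  ⟨fun h => h.1, fun h => ⟨h, fun _ _ _ h _ _ => h⟩⟩

lemma inter_bin_mem_choices {S : Finset ℕ} (hS : IsLegal b A 0 S) {n : ℕ} (hn : 1 ≤ n) :
    S ∩ bin b n ∈ choices b A n :=
  mem_filter.2 ⟨mem_powerset.2 inter_subset_right, hS.1 n hn⟩

lemma digits_union_map {S T : Finset ℕ} {n : ℕ}
    (hSn : S ⊆ range (binStart b (n + 1))) (hT : T ⊆ range (n + 1)) :
    digits b n (S ∪ T.map (addLeftEmbedding (binStart b (n + 1)))) = T := by
  ext j
  simp only [digits, mem_filter, mem_range, mem_union, Finset.mem_map, addLeftEmbedding_apply]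
  constructor
  · rintro ⟨hj, hS | ⟨i, hi, e⟩⟩
    · have := mem_range.1 (hSn hS); omega
    · obtain rfl : i = j := by omega
      exact hi
  · intro hj
    exact ⟨mem_range.1 (hT hj), Or.inr ⟨j, hj, rfl⟩⟩

lemma union_map_inter_range {S T : Finset ℕ} {n : ℕ} (hSn : S ⊆ range (binStart b (n + 1))) :
    (S ∪ T.map (addLeftEmbedding (binStart b (n + 1)))) ∩ range (binStart b (n + 1)) = S := by
  ext k
  simp only [mem_inter, mem_union, Finset.mem_map, addLeftEmbedding_apply, mem_range]
  constructor
  · rintro ⟨hS | ⟨j, -, rfl⟩, hk⟩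
    · exact hS
    · omega
  · intro hk
    exact ⟨Or.inl hk, mem_range.1 (hSn hk)⟩

namespace IsLinear

variable (h : IsLinear b A)

include h

lemma binStart_succ (n : ℕ) : binStart b (n + 2) = binStart b (n + 1) + (n + 1) := by
  rw [binStart, sum_Ico_succ_top (by omega), h.size _ (by omega)]; rfl

lemma le_binStart (n : ℕ) : n ≤ binStart b (n + 1) := by
  induction n with
  | zero => simp
  | succ n ih => rw [h.binStart_succ]; omega

lemma exists_position (k : ℕ) : ∃ n i, i < n + 1 ∧ k = binStart b (n + 1) + i := by
  induction k with
  | zero => exact ⟨0, 0, by omega, by rw [binStart_one]⟩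
  | succ k ih =>
    obtain ⟨n, i, hi, rfl⟩ := ih
    rcases Nat.lt_or_ge (i + 1) (n + 1) with h1 | h1
    · exact ⟨n, i + 1, h1, by omega⟩
    · exact ⟨n + 1, 0, by omega, by rw [h.binStart_succ]; omega⟩

lemma mem_bin_iff {n k : ℕ} :
    k ∈ bin b (n + 1) ↔ ∃ j < n + 1, k = binStart b (n + 1) + j := by
  rw [bin, mem_Ico, h.binStart_succ]
  exact ⟨fun hk => ⟨k - binStart b (n + 1), by omega, by omega⟩, by rintro ⟨j, hj, rfl⟩; omega⟩

lemma card_bin (n : ℕ) : #(bin b (n + 1)) = n + 1 := by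
  rw [bin, Nat.card_Ico, h.binStart_succ]; omega

lemma map_digits (n : ℕ) (S : Finset ℕ) :
    (digits b n S).map (addLeftEmbedding (binStart b (n + 1))) = S ∩ bin b (n + 1) := by
  ext k
  simp only [digits, Finset.mem_map, mem_filter, mem_range, addLeftEmbedding_apply, mem_inter,
    h.mem_bin_iff]
  constructor
  · rintro ⟨j, ⟨hj, hS⟩, rfl⟩; exact ⟨hS, j, hj, rfl⟩
  · rintro ⟨hS, j, hj, rfl⟩; exact ⟨j, ⟨hj, hS⟩, rfl⟩

lemma card_digits (n : ℕ) (S : Finset ℕ) : #(digits b n S) = #(S ∩ bin b (n + 1)) := by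
  rw [← h.map_digits, card_map]

lemma zero_mem_allowed (n : ℕ) : 0 ∈ A (n + 1) := by
  rcases h.allowed (n + 1) (by omega) with hA | hA <;> simp [hA]

lemma choices_eq (n : ℕ) :
    (A (n + 1) = range (n + 2) ∧ choices b A (n + 1) = (bin b (n + 1)).powerset) ∨
    (A (n + 1) = range (n + 1) ∧
      choices b A (n + 1) = (bin b (n + 1)).powerset.erase (bin b (n + 1))) := by
  rcases h.allowed (n + 1) (by omega) with hA | hA
  · refine Or.inr ⟨hA, ?_⟩
    ext T
    simp only [choices, mem_filter, mem_powerset, hA, mem_range, mem_erase]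
    constructor
    · rintro ⟨hT, hc⟩
      refine ⟨?_, hT⟩
      rintro rfl
      rw [h.card_bin] at hc
      omega
    · rintro ⟨hne, hT⟩
      have := card_lt_card (hT.ssubset_of_ne hne)
      rw [h.card_bin] at this
      exact ⟨hT, this⟩
  · refine Or.inl ⟨hA, ?_⟩
    rw [choices, filter_true_of_mem]
    intro T hT
    have := card_le_card (mem_powerset.1 hT)
    rw [h.card_bin] at this
    rw [hA, mem_range]
    omega

lemma card_choices_eq (n : ℕ) :
    (A (n + 1) = range (n + 2) ∧ #(choices b A (n + 1)) = 2 ^ (n + 1)) ∨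
    (A (n + 1) = range (n + 1) ∧ #(choices b A (n + 1)) = 2 ^ (n + 1) - 1) := by
  rcases h.choices_eq n with ⟨hA, e⟩ | ⟨hA, e⟩
  · exact Or.inl ⟨hA, by rw [e, card_powerset, h.card_bin]⟩
  · exact Or.inr ⟨hA, by rw [e, card_erase_of_mem (by simp), card_powerset, h.card_bin]⟩

lemma card_choices_pos (n : ℕ) : 0 < #(choices b A (n + 1)) := by
  have : 2 ≤ 2 ^ (n + 1) := by rw [pow_succ]; have := Nat.one_le_two_pow (n := n); omega
  rcases h.card_choices_eq n with ⟨-, e⟩ | ⟨-, e⟩ <;> omega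

lemma totalChoices_pos (N : ℕ) : 0 < totalChoices b A N := by
  induction N with
  | zero => simp [totalChoices]
  | succ N ih => rw [totalChoices_succ]; exact Nat.mul_pos ih (h.card_choices_pos N)

lemma le_totalChoices (N : ℕ) : N ≤ totalChoices b A N := by
  cases N with
  | zero => simp
  | succ N =>
    rw [totalChoices_succ]
    refine le_trans ?_ (Nat.le_mul_of_pos_left _ (h.totalChoices_pos N))
    have : N + 1 < 2 ^ (N + 1) := Nat.lt_two_pow_self
    rcases h.card_choices_eq N with ⟨-, e⟩ | ⟨-, e⟩ <;> omega

/-- An allowed choice from a bin is one whose binary value is less than the number of choices. -/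
lemma card_mem_allowed_iff {n : ℕ} {T : Finset ℕ} (hT : T ⊆ range (n + 1)) :
    #T ∈ A (n + 1) ↔ ∑ j ∈ T, 2 ^ j < #(choices b A (n + 1)) := by
  have h1 := sum_two_pow_lt_of_subset_range hT
  rcases h.card_choices_eq n with ⟨hA, e⟩ | ⟨hA, e⟩
  · rw [e, hA, mem_range]
    have := card_le_card hT
    rw [card_range] at this
    exact iff_of_true (by omega) h1
  · rw [e, hA, mem_range]
    -- The forbidden full choice is the only one with binary value 2^(n+1) - 1.
    have key : T = range (n + 1) ↔ ∑ j ∈ T, 2 ^ j = 2 ^ (n + 1) - 1 := by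
      rw [← sum_two_pow_range]
      exact ⟨fun e => by rw [e], fun e => Finset.geomSum_injective le_rfl e⟩
    have h2 : #T < n + 1 ↔ T ≠ range (n + 1) := by
      refine ⟨fun hc e => by simp [e] at hc, fun hne => ?_⟩
      simpa using card_lt_card (hT.ssubset_of_ne hne)
    rw [h2, Ne, key]
    omega

/-- Isolates the top digit. The weights are prescribed only at positions in `S`, so that partially
constructed bins are covered too. -/
lemma sum_eq_add_digits {w : ℕ → ℕ} {S : Finset ℕ} {n : ℕ} (hS : S ⊆ range (binStart b (n + 2)))
    {c : ℕ} (hw : ∀ j < n + 1, binStart b (n + 1) + j ∈ S → w (binStart b (n + 1) + j) = c * 2 ^ j) :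
    ∑ k ∈ S, w k = ∑ k ∈ S ∩ range (binStart b (n + 1)), w k + c * ∑ j ∈ digits b n S, 2 ^ j := by
  have hd : Disjoint (S ∩ range (binStart b (n + 1))) (S ∩ bin b (n + 1)) := by
    rw [Finset.disjoint_left]
    intro k hk hk'
    simp only [mem_inter, mem_range, bin, mem_Ico] at hk hk'
    omega
  have hu : S = (S ∩ range (binStart b (n + 1))) ∪ (S ∩ bin b (n + 1)) := by
    ext k
    have := @hS k
    simp only [mem_union, mem_inter, mem_range, bin, mem_Ico] at this ⊢
    constructor
    · intro hk; have := this hk; rcases Nat.lt_or_ge k (binStart b (n + 1)) with h1 | h1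
      · exact Or.inl ⟨hk, h1⟩
      · exact Or.inr ⟨hk, h1, this⟩
    · rintro (hk | hk) <;> exact hk.1
  conv_lhs => rw [hu]
  rw [sum_union hd, ← h.map_digits, sum_map, mul_sum]
  congr 1
  refine sum_congr rfl fun j hj => ?_
  rw [digits, mem_filter, mem_range] at hj
  exact hw j hj.1 hj.2

lemma isLegal_inter_range {S : Finset ℕ} (hS : IsLegal b A 0 S) (n : ℕ) :
    IsLegal b A 0 (S ∩ range (binStart b (n + 1))) := by
  rw [isLegal_zero_iff] at hS ⊢
  intro m hm
  obtain ⟨m, rfl⟩ : ∃ m', m = m' + 1 := ⟨m - 1, by omega⟩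
  rcases Nat.lt_or_ge m n with hmn | hmn
  · convert hS (m + 1) hm using 2
    ext k
    have hle : binStart b (m + 1 + 1) ≤ binStart b (n + 1) := binStart_mono (by omega)
    simp only [mem_inter, mem_range, bin, mem_Ico]
    constructor
    · tauto
    · rintro ⟨h1, h2, h3⟩; exact ⟨⟨h1, by omega⟩, h2, h3⟩
  · convert h.zero_mem_allowed m
    rw [card_eq_zero, ← not_nonempty_iff_eq_empty]
    rintro ⟨k, hk⟩
    have hle : binStart b (n + 1) ≤ binStart b (m + 1) := binStart_mono (by omega)
    simp only [mem_inter, mem_range, bin, mem_Ico] at hk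
    omega

/-- A legal choice from the bins `1, …, n` together with an allowed choice from bin `n + 1`. -/
lemma isLegal_union_map {S T : Finset ℕ} {n : ℕ} (hS : IsLegal b A 0 S)
    (hSn : S ⊆ range (binStart b (n + 1))) (hT : T ⊆ range (n + 1)) (hc : #T ∈ A (n + 1)) :
    IsLegal b A 0 (S ∪ T.map (addLeftEmbedding (binStart b (n + 1)))) := by
  rw [isLegal_zero_iff] at hS ⊢
  intro m hm
  have hTb : T.map (addLeftEmbedding (binStart b (n + 1))) ⊆ bin b (n + 1) := by
    intro k hk
    obtain ⟨j, hj, rfl⟩ := Finset.mem_map.1 hk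
    exact h.mem_bin_iff.2 ⟨j, mem_range.1 (hT hj), rfl⟩
  rw [union_inter_distrib_right]
  by_cases hmn : m = n + 1
  · subst hmn
    have : S ∩ bin b (n + 1) = ∅ := by
      rw [← disjoint_iff_inter_eq_empty, Finset.disjoint_left]
      intro k hk hk'
      have := hSn hk
      simp only [mem_range, bin, mem_Ico] at this hk'
      omega
    rw [this, empty_union, inter_eq_left.2 hTb, card_map]
    exact hc
  · have : T.map (addLeftEmbedding (binStart b (n + 1))) ∩ bin b m = ∅ := by
      rw [← disjoint_iff_inter_eq_empty]
      exact disjoint_of_subset_left hTb (bin_disjoint (Ne.symm hmn))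
    rw [this, union_empty]
    exact hS m hm

end IsLinear

/-- The weights `w` of the positions below `k` are those of a mixed radix numeral system. -/
def IsMixedRadix (b : ℕ → ℕ) (A : ℕ → Finset ℕ) (w : ℕ → ℕ) (k : ℕ) : Prop :=
  ∀ n i, i < n + 1 → binStart b (n + 1) + i < k →
    w (binStart b (n + 1) + i) = totalChoices b A n * 2 ^ i

lemma IsMixedRadix.mono {w : ℕ → ℕ} {k l : ℕ} (hw : IsMixedRadix b A w k) (hl : l ≤ k) :
    IsMixedRadix b A w l := fun n i hi hk => hw n i hi (hk.trans_le hl)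

/-! ### Mixed radix representation and the greedy sequence -/

namespace IsLinear

variable (h : IsLinear b A)

include h

lemma sum_lt_totalChoices {w : ℕ → ℕ} (N : ℕ) (hw : IsMixedRadix b A w (binStart b (N + 1)))
    {S : Finset ℕ} (hS : IsLegal b A 0 S) (hSN : S ⊆ range (binStart b (N + 1))) :
    ∑ k ∈ S, w k < totalChoices b A N := by
  induction N generalizing S with
  | zero =>
    rw [binStart_one] at hSN
    simp [subset_empty.1 hSN, totalChoices]
  | succ N ih =>
    rw [h.sum_eq_add_digits hSN fun j hj hjS => hw N j hj (mem_range.1 (hSN hjS)), totalChoices_succ]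
    have h1 := ih (hw.mono (binStart_mono (by omega))) (h.isLegal_inter_range hS N) inter_subset_right
    have h2 : ∑ j ∈ digits b N S, 2 ^ j < #(choices b A (N + 1)) := by
      rw [← h.card_mem_allowed_iff (T := digits b N S) (filter_subset _ _), h.card_digits]
      exact hS.1 _ (by omega)
    nlinarith

/-- Remainder and quotient modulo M_N recover the part in the lower bins and the top digit;
uniqueness of binary expansions then recovers the choice from the top bin. -/
lemma eq_of_sum_eq {w : ℕ → ℕ} (N : ℕ) (hw : IsMixedRadix b A w (binStart b (N + 1)))
    {S T : Finset ℕ} (hS : IsLegal b A 0 S) (hT : IsLegal b A 0 T)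
    (hSN : S ⊆ range (binStart b (N + 1))) (hTN : T ⊆ range (binStart b (N + 1)))
    (e : ∑ k ∈ S, w k = ∑ k ∈ T, w k) : S = T := by
  induction N generalizing S T with
  | zero =>
    rw [binStart_one] at hSN hTN
    rw [subset_empty.1 hSN, subset_empty.1 hTN]
  | succ N ih =>
    rw [h.sum_eq_add_digits hSN fun j hj hjS => hw N j hj (mem_range.1 (hSN hjS)),
      h.sum_eq_add_digits hTN fun j hj hjS => hw N j hj (mem_range.1 (hTN hjS))] at e
    have hw' := hw.mono (binStart_mono (b := b) (show N + 1 ≤ N + 2 by omega))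
    have h1 := h.sum_lt_totalChoices N hw' (h.isLegal_inter_range hS N) inter_subset_right
    have h2 := h.sum_lt_totalChoices N hw' (h.isLegal_inter_range hT N) inter_subset_right
    have hp := h.totalChoices_pos N
    have e1 := congrArg (· % totalChoices b A N) e
    have e2 := congrArg (· / totalChoices b A N) e
    simp only [Nat.add_mul_mod_self_left, Nat.mod_eq_of_lt h1, Nat.mod_eq_of_lt h2] at e1
    simp only [Nat.add_mul_div_left _ _ hp, Nat.div_eq_of_lt h1, Nat.div_eq_of_lt h2,
      zero_add] at e2
    have e3 : digits b N S = digits b N T := Finset.geomSum_injective le_rfl e2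
    have e4 := ih hw' (h.isLegal_inter_range hS N) (h.isLegal_inter_range hT N)
      inter_subset_right inter_subset_right e1
    have key : ∀ R ⊆ range (binStart b (N + 1 + 1)), R = (R ∩ range (binStart b (N + 1))) ∪
        (digits b N R).map (addLeftEmbedding (binStart b (N + 1))) := by
      intro R hR
      rw [h.map_digits, ← inter_union_distrib_left, eq_comm, inter_eq_left]
      intro k hk
      have := mem_range.1 (hR hk)
      simp only [mem_union, mem_range, bin, mem_Ico]
      omega
    rw [key S hSN, key T hTN, e3, e4]

/-- Serves both a whole bin (`i = N + 1`) and an initial segment of it. The bound `hx` fits the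
quotient by M_N into `i` binary digits, and `hx'` makes these digits an allowed choice. -/
lemma exists_isLegal_union {w : ℕ → ℕ} {N i : ℕ} (hi : i ≤ N + 1)
    (hw : IsMixedRadix b A w (binStart b (N + 1) + i))
    (ih : ∀ x < totalChoices b A N, ∃ S, IsLegal b A 0 S ∧ S ⊆ range (binStart b (N + 1)) ∧
      ∑ k ∈ S, w k = x)
    {x : ℕ} (hx : x < totalChoices b A N * 2 ^ i)
    (hx' : x < totalChoices b A N * #(choices b A (N + 1))) :
    ∃ S, IsLegal b A 0 S ∧ S ⊆ range (binStart b (N + 1) + i) ∧ ∑ k ∈ S, w k = x := by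
  have hp := h.totalChoices_pos N
  obtain ⟨S, hS, hSN, hSx⟩ := ih (x % totalChoices b A N) (Nat.mod_lt _ hp)
  obtain ⟨T, hT, hTx⟩ := exists_subset_range_sum_two_pow
    (n := i) (y := x / totalChoices b A N) (Nat.div_lt_of_lt_mul hx)
  have hTN : T ⊆ range (N + 1) := hT.trans (range_subset_range.2 hi)
  have hsub : S ∪ T.map (addLeftEmbedding (binStart b (N + 1))) ⊆
      range (binStart b (N + 1) + i) := by
    intro k hk
    rw [mem_union, Finset.mem_map] at hk
    rcases hk with hk | ⟨j, hj, rfl⟩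
    · have := mem_range.1 (hSN hk)
      exact mem_range.2 (by omega)
    · have := mem_range.1 (hT hj)
      exact mem_range.2 (by simp; omega)
  refine ⟨S ∪ T.map (addLeftEmbedding (binStart b (N + 1))), h.isLegal_union_map hS hSN hTN ?_,
    hsub, ?_⟩
  · rw [h.card_mem_allowed_iff hTN, hTx]
    exact Nat.div_lt_of_lt_mul hx'
  · rw [h.sum_eq_add_digits (n := N) (c := totalChoices b A N), digits_union_map hSN hTN,
      union_map_inter_range hSN, hSx, hTx, Nat.mod_add_div]
    · refine hsub.trans (range_subset_range.2 ?_)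
      rw [h.binStart_succ]; omega
    · intro j hj hjS
      exact hw N j hj (mem_range.1 (hsub hjS))

lemma exists_isLegal_sum_eq {w : ℕ → ℕ} (N : ℕ) (hw : IsMixedRadix b A w (binStart b (N + 1)))
    (x : ℕ) (hx : x < totalChoices b A N) :
    ∃ S, IsLegal b A 0 S ∧ S ⊆ range (binStart b (N + 1)) ∧ ∑ k ∈ S, w k = x := by
  induction N generalizing x with
  | zero =>
    refine ⟨∅, isLegal_zero_iff.2 fun n hn => ?_, by simp, ?_⟩
    · obtain ⟨m, rfl⟩ : ∃ m', n = m' + 1 := ⟨n - 1, by omega⟩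
      simpa using h.zero_mem_allowed m
    · simp [totalChoices] at hx
      simp [hx]
  | succ N ih =>
    rw [totalChoices_succ] at hx
    rw [h.binStart_succ] at hw ⊢
    have hle : #(choices b A (N + 1)) ≤ 2 ^ (N + 1) := by
      rcases h.card_choices_eq N with ⟨-, e⟩ | ⟨-, e⟩ <;> rw [e]; exact Nat.sub_le _ _
    exact h.exists_isLegal_union le_rfl hw (fun x hx => ih (hw.mono (by omega)) x hx)
      (hx.trans_le (Nat.mul_le_mul_left _ hle)) hx

/-- The sums of the legal choices from the bins `1, …, N` and the first `i` terms of bin `N + 1`. -/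
lemma exists_isLegal_iff_lt {w : ℕ → ℕ} {N i : ℕ} (hi : i < N + 1)
    (hw : IsMixedRadix b A w (binStart b (N + 1) + i)) (x : ℕ) :
    (∃ S, IsLegal b A 0 S ∧ S ⊆ range (binStart b (N + 1) + i) ∧ ∑ k ∈ S, w k = x) ↔
      x < totalChoices b A N * 2 ^ i := by
  constructor
  · rintro ⟨S, hS, hSi, rfl⟩
    rw [h.sum_eq_add_digits (n := N) (c := totalChoices b A N)
      (hSi.trans (range_subset_range.2 (by rw [h.binStart_succ]; omega)))
      fun j hj hjS => hw N j hj (mem_range.1 (hSi hjS))]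
    have h1 := h.sum_lt_totalChoices N (hw.mono (by omega)) (h.isLegal_inter_range hS N)
      inter_subset_right
    have h2 : ∑ j ∈ digits b N S, 2 ^ j < 2 ^ i := by
      refine sum_two_pow_lt_of_subset_range fun j hj => ?_
      have := mem_range.1 (hSi (mem_filter.1 hj).2)
      exact mem_range.2 (by omega)
    nlinarith
  · intro hx
    -- A proper initial segment of a bin contains no forbidden choice: `i ≤ N`, and even 2^(N+1) - 1
    -- is at least 2^N.
    have hle : 2 ^ i ≤ #(choices b A (N + 1)) := by
      have h1 : 2 ^ i ≤ 2 ^ N := Nat.pow_le_pow_right (by omega) (by omega)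
      have h2 : 1 ≤ 2 ^ N := Nat.one_le_two_pow
      rcases h.card_choices_eq N with ⟨-, e⟩ | ⟨-, e⟩ <;> rw [e, pow_succ]
      · linarith
      · exact Nat.le_sub_of_add_le (by linarith)
    exact h.exists_isLegal_union hi.le hw
      (fun x hx => h.exists_isLegal_sum_eq N (hw.mono (by omega)) x hx) hx
      (hx.trans_le (Nat.mul_le_mul_left _ hle))

lemma isMixedRadix_seq (k : ℕ) : IsMixedRadix b A (seq b A 0) k := by
  induction k with
  | zero => intro n i _ hk; omega
  | succ k ih =>
    intro n i hi hk
    rcases Nat.lt_or_ge (binStart b (n + 1) + i) k with hlt | hge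
    · exact ih n i hi hlt
    obtain rfl : k = binStart b (n + 1) + i := by omega
    -- By induction the earlier terms represent exactly the integers below M_n 2^i, so the set whose
    -- infimum is the next term is a half-line.
    have hset : {x : ℕ | 0 < x ∧ ¬ ∃ S : Finset (Fin (binStart b (n + 1) + i)),
        IsLegal b A 0 (S.map Fin.valEmbedding) ∧ ∑ j ∈ S, seq b A 0 j = x} =
        Set.Ici (totalChoices b A n * 2 ^ i) := by
      ext x
      have hp : 0 < totalChoices b A n * 2 ^ i := Nat.mul_pos (h.totalChoices_pos n) (by positivity)
      have := h.exists_isLegal_iff_lt hi ih x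
      rw [Set.mem_ofPred_eq, Set.mem_Ici, ← not_lt, ← this]
      constructor
      · rintro ⟨-, hx⟩ ⟨S, hS, hSk, hSx⟩
        refine hx ⟨S.attachFin fun m hm => mem_range.1 (hSk hm), ?_, ?_⟩
        · rwa [map_valEmbedding_attachFin]
        · rw [← hSx]
          conv_rhs => rw [← map_valEmbedding_attachFin fun m hm => mem_range.1 (hSk hm), sum_map]
          rfl
      · intro hx
        refine ⟨?_, ?_⟩
        · rw [this, not_lt] at hx
          omega
        · rintro ⟨S, hS, hSx⟩
          refine hx ⟨S.map Fin.valEmbedding, hS, ?_, ?_⟩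
          · intro m hm
            obtain ⟨j, -, rfl⟩ := Finset.mem_map.1 hm
            exact mem_range.2 j.2
          · rw [sum_map]; exact hSx
    -- Position 0 is separate: its term is 1 by definition and not by the greedy rule.
    rcases Nat.eq_zero_or_pos (binStart b (n + 1) + i) with h0 | h0
    · rw [h0]
      obtain rfl : i = 0 := by omega
      obtain rfl : n = 0 := by have := h.le_binStart n; omega
      simp [seq, totalChoices]
    · obtain ⟨k, hk'⟩ : ∃ k, binStart b (n + 1) + i = k + 1 := ⟨_, (Nat.sub_add_cancel h0).symm⟩
      rw [hk'] at hset ⊢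
      rw [seq, hset, csInf_Ici]

lemma seq_eq {n i : ℕ} (hi : i < n + 1) :
    seq b A 0 (binStart b (n + 1) + i) = totalChoices b A n * 2 ^ i :=
  h.isMixedRadix_seq _ n i hi (Nat.lt_succ_self _)

lemma subset_range_binStart (S : Finset ℕ) : ∃ N, S ⊆ range (binStart b (N + 1)) := by
  refine ⟨S.sup id + 1, fun k hk => mem_range.2 ?_⟩
  have h1 : k ≤ S.sup id := le_sup (f := id) hk
  have h2 := h.le_binStart (S.sup id + 1)
  omega

lemma isDecomposition_unique {S T : Finset ℕ} {x : ℕ} (hS : IsDecomposition b A 0 S x)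
    (hT : IsDecomposition b A 0 T x) : S = T := by
  obtain ⟨N, hN⟩ := h.subset_range_binStart (S ∪ T)
  exact h.eq_of_sum_eq N (h.isMixedRadix_seq _) hS.1 hT.1 (subset_union_left.trans hN)
    (subset_union_right.trans hN) (hS.2.trans hT.2.symm)

lemma existsUnique_isDecomposition (x : ℕ) : ∃! S, IsDecomposition b A 0 S x := by
  obtain ⟨S, hS, -, hSx⟩ := h.exists_isLegal_sum_eq (x + 1) (h.isMixedRadix_seq _) x
    (h.le_totalChoices (x + 1))
  exact ⟨S, ⟨hS, hSx⟩, fun T hT => h.isDecomposition_unique hT ⟨hS, hSx⟩⟩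

lemma isDecomposition_decomp (x : ℕ) : IsDecomposition b A 0 (decomp b A 0 x) x := by
  have hx := (h.existsUnique_isDecomposition x).exists
  rw [decomp, dif_pos hx]
  exact hx.choose_spec

lemma decomp_eq {S : Finset ℕ} {x : ℕ} (hS : IsDecomposition b A 0 S x) : decomp b A 0 x = S :=
  h.isDecomposition_unique (h.isDecomposition_decomp x) hS

lemma decomp_subset_iff {x N : ℕ} :
    decomp b A 0 x ⊆ range (binStart b (N + 1)) ↔ x < totalChoices b A N := by
  have hd := h.isDecomposition_decomp x
  constructor
  · intro hs
    have := h.sum_lt_totalChoices N (h.isMixedRadix_seq _) hd.1 hs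
    rwa [hd.2] at this
  · intro hx
    obtain ⟨S, hS, hSN, hSx⟩ := h.exists_isLegal_sum_eq N (h.isMixedRadix_seq _) x hx
    rwa [h.decomp_eq ⟨hS, hSx⟩]

lemma generatedBy_eq (N : ℕ) : generatedBy b A 0 N = ↑(range (totalChoices b A N)) := by
  ext x
  rw [mem_coe, mem_range, ← h.decomp_subset_iff]
  constructor
  · rintro ⟨S, hS, hSN⟩
    rw [h.decomp_eq hS]
    exact fun i hi => mem_range.2 (hSN i hi)
  · exact fun hs => ⟨_, h.isDecomposition_decomp x, fun i hi => mem_range.1 (hs hi)⟩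

end IsLinear

end BinSeq

/-! ### Independence of the bins under uniform measures -/

namespace BinSeq

variable {b : ℕ → ℕ} {A : ℕ → Finset ℕ}

lemma mem_choices_iff {n : ℕ} {T : Finset ℕ} :
    T ∈ choices b A n ↔ T ⊆ bin b n ∧ #T ∈ A n := by
  rw [choices, mem_filter, mem_powerset]

namespace IsLinear

variable (h : IsLinear b A)

include h

lemma map_digits_of_subset {n : ℕ} {T : Finset ℕ} (hT : T ⊆ bin b (n + 1)) :
    (digits b n T).map (addLeftEmbedding (binStart b (n + 1))) = T := by
  rw [h.map_digits, inter_eq_left.2 hT]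

-- Splitting off the last bin reduces this to distributivity. The weights `f` are arbitrary so that
-- indicator functions later give all the counts at once.
open Classical in
lemma sum_prod_legal {R : Type*} [CommSemiring R] (f : ℕ → Finset ℕ → R) (N : ℕ) :
    ∑ S ∈ (range (binStart b (N + 1))).powerset with IsLegal b A 0 S,
      ∏ n ∈ Icc 1 N, f n (S ∩ bin b n) = ∏ n ∈ Icc 1 N, ∑ T ∈ choices b A n, f n T := by
  induction N with
  | zero =>
    have : IsLegal b A 0 ∅ := isLegal_zero_iff.2 fun n hn => by
      obtain ⟨m, rfl⟩ : ∃ m', n = m' + 1 := ⟨n - 1, by omega⟩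
      simpa using h.zero_mem_allowed m
    simp [binStart_one, filter_singleton, this]
  | succ N ih =>
    rw [prod_Icc_succ_top (by omega), ← ih, sum_mul_sum, ← sum_product']
    refine sum_nbij' (fun S => (S ∩ range (binStart b (N + 1)), S ∩ bin b (N + 1)))
      (fun p => p.1 ∪ p.2) ?_ ?_ ?_ ?_ ?_
    · intro S hS
      simp only [mem_filter, mem_powerset] at hS
      simp only [mem_product, mem_filter, mem_powerset]
      exact ⟨⟨inter_subset_right, h.isLegal_inter_range hS.2 N⟩,
        inter_bin_mem_choices hS.2 (by omega)⟩
    · rintro ⟨S, T⟩ hST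
      simp only [mem_product, mem_filter, mem_powerset, mem_choices_iff] at hST
      obtain ⟨⟨hSN, hS⟩, hT, hc⟩ := hST
      simp only [mem_filter, mem_powerset]
      refine ⟨union_subset (hSN.trans (range_subset_range.2 (binStart_mono (by omega)))) ?_, ?_⟩
      · intro k hk
        exact mem_range.2 (mem_Ico.1 (hT hk)).2
      · have := h.isLegal_union_map (T := digits b N T) hS hSN (filter_subset _ _)
          (by rwa [h.card_digits, inter_eq_left.2 hT])
        rwa [h.map_digits_of_subset hT] at this
    · intro S hS
      simp only [mem_filter, mem_powerset] at hS
      rw [← inter_union_distrib_left, inter_eq_left]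
      intro k hk
      have := mem_range.1 (hS.1 hk)
      simp only [mem_union, mem_range, bin, mem_Ico]
      omega
    · rintro ⟨S, T⟩ hST
      simp only [mem_product, mem_filter, mem_powerset, mem_choices_iff] at hST
      obtain ⟨⟨hSN, hS⟩, hT, hc⟩ := hST
      have h1 : S ∩ bin b (N + 1) = ∅ := by
        rw [← disjoint_iff_inter_eq_empty, Finset.disjoint_left]
        intro k hk hk'
        have := mem_range.1 (hSN hk)
        have := (mem_Ico.1 hk').1
        omega
      have h2 : T ∩ range (binStart b (N + 1)) = ∅ := by
        rw [← disjoint_iff_inter_eq_empty, Finset.disjoint_left]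
        intro k hk hk'
        have := mem_range.1 hk'
        have := (mem_Ico.1 (hT hk)).1
        omega
      rw [union_inter_distrib_right, union_inter_distrib_right, h1, h2, union_empty, empty_union,
        inter_eq_left.2 hSN, inter_eq_left.2 hT]
    · intro S _
      rw [prod_Icc_succ_top (by omega)]
      congr 1
      refine prod_congr rfl fun n hn => ?_
      rw [inter_assoc]
      congr 2
      refine (inter_eq_right.2 fun k hk => mem_range.2 ?_).symm
      have : binStart b (n + 1) ≤ binStart b (N + 1) :=
        binStart_mono (by have := (mem_Icc.1 hn).2; omega)
      exact (mem_Ico.1 hk).2.trans_le this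

lemma sum_prod_decomp {R : Type*} [CommSemiring R] (f : ℕ → Finset ℕ → R) (N : ℕ) :
    ∑ x ∈ range (totalChoices b A N), ∏ n ∈ Icc 1 N, f n (decomp b A 0 x ∩ bin b n) =
      ∏ n ∈ Icc 1 N, ∑ T ∈ choices b A n, f n T := by
  classical
  rw [← h.sum_prod_legal]
  refine sum_nbij' (decomp b A 0) (fun S => ∑ k ∈ S, seq b A 0 k) ?_ ?_ ?_ ?_ ?_
  · intro x hx
    rw [mem_filter, mem_powerset, h.decomp_subset_iff]
    exact ⟨mem_range.1 hx, (h.isDecomposition_decomp x).1⟩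
  · intro S hS
    rw [mem_filter, mem_powerset] at hS
    exact mem_range.2 (h.sum_lt_totalChoices N (h.isMixedRadix_seq _) hS.2 hS.1)
  · intro x _
    exact (h.isDecomposition_decomp x).2
  · intro S hS
    exact h.decomp_eq ⟨(mem_filter.1 hS).2, rfl⟩
  · intro x _
    rfl

end IsLinear

open Classical in
/-- The integers whose decomposition uses the bins `1, …, N` only, with the terms chosen from bin
`n` forming a member of `K n`. -/
noncomputable def restricted (b : ℕ → ℕ) (A : ℕ → Finset ℕ) (K : ℕ → Finset (Finset ℕ)) (N : ℕ) :
    Finset ℕ :=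
  {x ∈ range (totalChoices b A N) | ∀ n ∈ Icc 1 N, decomp b A 0 x ∩ bin b n ∈ K n}

lemma mem_restricted {K : ℕ → Finset (Finset ℕ)} {N x : ℕ} : x ∈ restricted b A K N ↔
    x < totalChoices b A N ∧ ∀ n ∈ Icc 1 N, decomp b A 0 x ∩ bin b n ∈ K n := by
  simp only [restricted, mem_filter, mem_range]

/-- `X` is distributed as the size of a uniformly random member of `K`. -/
def HasCountLaw {Ω : Type*} [MeasurableSpace Ω] (P : Measure Ω) (X : Ω → ℕ)
    (K : Finset (Finset ℕ)) : Prop :=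
  ∀ i : ℕ, P.real {ω | X ω = i} = (#{T ∈ K | #T = i} : ℝ) / #K

section Restricted

variable (h : IsLinear b A) {K : ℕ → Finset (Finset ℕ)} {N : ℕ}
  (hK : ∀ n ∈ Icc 1 N, K n ⊆ choices b A n)

include h hK

open Classical in
lemma card_restricted_filter (p : ℕ → Finset ℕ → Prop) :
    #{x ∈ restricted b A K N | ∀ n ∈ Icc 1 N, p n (decomp b A 0 x ∩ bin b n)} =
      ∏ n ∈ Icc 1 N, #{T ∈ K n | p n T} := by
  have := h.sum_prod_decomp (fun n T => if T ∈ K n ∧ p n T then 1 else 0) N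
  simp_rw [prod_ite_zero, prod_const_one] at this
  rw [sum_boole, Nat.cast_id] at this
  rw [restricted, filter_filter]
  simp_rw [← forall₂_and]
  rw [this]
  refine prod_congr rfl fun n hn => ?_
  rw [sum_boole, Nat.cast_id]
  congr 1
  ext T
  simp only [mem_filter]
  exact ⟨fun hT => hT.2, fun hT => ⟨hK n hn hT.1, hT⟩⟩

lemma card_restricted : #(restricted b A K N) = ∏ n ∈ Icc 1 N, #(K n) := by
  classical
  simpa using card_restricted_filter h hK fun _ _ => True

lemma uniformOn_restricted_real (p : ℕ → Finset ℕ → Prop) [∀ n, DecidablePred (p n)] :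
    (uniformOn (restricted b A K N : Set ℕ)).real
      {x | ∀ n ∈ Icc 1 N, p n (decomp b A 0 x ∩ bin b n)} =
      ∏ n ∈ Icc 1 N, (#{T ∈ K n | p n T} : ℝ) / #(K n) := by
  classical
  rw [prod_div_distrib, ← Nat.cast_prod, ← Nat.cast_prod, ← card_restricted h hK]
  obtain ⟨F, hF, hc⟩ : ∃ F ⊆ restricted b A K N, (F : Set ℕ) = ↑(restricted b A K N) ∩
      {x | ∀ n ∈ Icc 1 N, p n (decomp b A 0 x ∩ bin b n)} ∧
      #F = ∏ n ∈ Icc 1 N, #{T ∈ K n | p n T} := by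
    refine ⟨{x ∈ restricted b A K N | ∀ n ∈ Icc 1 N, p n (decomp b A 0 x ∩ bin b n)},
      filter_subset _ _, by ext; simp, ?_⟩
    convert card_restricted_filter h hK p
  rw [← hc.2, measureReal_def, ← uniformOn_inter_self (finite_toSet _), ← hc.1,
    uniformOn_apply_finset, inter_eq_right.2 hF]
  simp

variable (hne : ∀ n ∈ Icc 1 N, (K n).Nonempty)

include hne

lemma restricted_nonempty : (restricted b A K N).Nonempty := by
  rw [← card_pos, card_restricted h hK]
  exact prod_pos fun n hn => card_pos.2 (hne n hn)

lemma isProbabilityMeasure_uniformOn_restricted :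
    IsProbabilityMeasure (uniformOn (restricted b A K N : Set ℕ)) :=
  isProbabilityMeasure_uniformOn (finite_toSet _) (restricted_nonempty h hK hne)

lemma hasCountLaw_binCount {n : ℕ} (hn : n ∈ Icc 1 N) :
    HasCountLaw (uniformOn (restricted b A K N : Set ℕ)) (binCount b A 0 n) (K n) := by
  intro i
  -- The condition is vacuous in the bins other than `n`, whose factors are 1 because the families
  -- are nonempty.
  have := uniformOn_restricted_real h hK fun m T => m = n → #T = i
  rw [prod_eq_single n] at this
  · simp only [forall_const] at this
    rw [← this]
    congr 1
    ext x
    simp only [Set.mem_ofPred_eq, binCount]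
    exact ⟨fun hx m _ hm => by rw [hm, hx], fun hx => hx n hn rfl⟩
  · intro m hm hmn
    simp only [hmn, false_imp_iff, filter_true]
    exact div_self (Nat.cast_ne_zero.2 (card_pos.2 (hne m hm)).ne')
  · exact fun hn' => absurd hn hn'

/-- On a countable space it suffices to compare point masses, and these factor by
`uniformOn_restricted_real`. -/
lemma iIndepFun_binCount :
    iIndepFun (fun (n : Icc 1 N) => binCount b A 0 n)
      (uniformOn (restricted b A K N : Set ℕ)) := by
  have := isProbabilityMeasure_uniformOn_restricted h hK hne
  rw [iIndepFun_iff_map_fun_eq_pi_map fun _ => (measurable_of_countable _).aemeasurable]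
  refine Measure.ext_of_singleton fun y => ?_
  have : ∀ n : Icc 1 N, IsProbabilityMeasure
      ((uniformOn (restricted b A K N : Set ℕ)).map (binCount b A 0 n)) := fun n =>
    Measure.isProbabilityMeasure_map (measurable_of_countable _).aemeasurable
  rw [Measure.pi_singleton, Measure.map_apply (measurable_of_countable _) (measurableSet_singleton _),
    ← ENNReal.toReal_eq_toReal_iff' (measure_ne_top _ _)
      (ENNReal.prod_ne_top fun _ _ => measure_ne_top _ _), ENNReal.toReal_prod]
  have e : ∀ n : Icc 1 N, (((uniformOn (restricted b A K N : Set ℕ)).map (binCount b A 0 n))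
      {y n}).toReal = (#{T ∈ K n | #T = y n} : ℝ) / #(K n) := by
    intro n
    rw [Measure.map_apply (measurable_of_countable _) (measurableSet_singleton _)]
    exact hasCountLaw_binCount h hK hne n.2 (y n)
  simp_rw [e]
  have key := uniformOn_restricted_real h hK fun m T => ∀ hm : m ∈ Icc 1 N, #T = y ⟨m, hm⟩
  rw [← prod_coe_sort] at key
  convert key using 1
  · rw [measureReal_def]
    congr 2
    ext x
    simp only [Set.mem_preimage, Set.mem_singleton_iff, Set.mem_ofPred_eq, funext_iff, binCount,
      Subtype.forall]
    exact ⟨fun hx n hn _ => hx n hn, fun hx n hn => hx n hn hn⟩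
  · refine prod_congr rfl fun n _ => ?_
    simp [n.2]

end Restricted

/-! ### Expectations as finite averages -/

section CountLaw

variable {Ω : Type*} [MeasurableSpace Ω] {P : Measure Ω} [IsProbabilityMeasure P] {X : Ω → ℕ}
  {K : Finset (Finset ℕ)}

lemma HasCountLaw.map_eq (hX : Measurable X) (hl : HasCountLaw P X K) :
    P.map X = ∑ T ∈ K, ENNReal.ofReal (1 / #K) • Measure.dirac #T := by
  refine Measure.ext_of_singleton fun i => ?_
  rw [Measure.map_apply hX (measurableSet_singleton _), Measure.finsetSum_apply]
  have e : P (X ⁻¹' {i}) = ENNReal.ofReal ((#{T ∈ K | #T = i} : ℝ) / #K) := by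
    rw [← hl i, ofReal_measureReal]; rfl
  rw [e]
  simp only [Measure.smul_apply, smul_eq_mul, measurableSet_singleton, Measure.dirac_apply',
    Set.indicator_apply, Set.mem_singleton_iff, Pi.one_apply, mul_ite, mul_one, mul_zero]
  rw [← sum_filter, sum_const, nsmul_eq_mul, div_eq_mul_one_div, ENNReal.ofReal_mul (by positivity),
    ENNReal.ofReal_natCast]

lemma HasCountLaw.integral_eq (hX : Measurable X) (hl : HasCountLaw P X K) (g : ℕ → ℝ) :
    ∫ ω, g (X ω) ∂P = (∑ T ∈ K, g #T) / #K := by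
  rw [← integral_map (f := g) hX.aemeasurable (measurable_of_countable g).aestronglyMeasurable,
    hl.map_eq hX, integral_finsetSum_measure]
  · simp_rw [integral_smul_measure, integral_dirac]
    rw [ENNReal.toReal_ofReal (by positivity), ← smul_sum, smul_eq_mul]
    ring
  · intro T _
    refine Integrable.smul_measure ?_ ENNReal.ofReal_ne_top
    exact integrable_dirac (by simp)

lemma HasCountLaw.ae_le (hX : Measurable X) (hl : HasCountLaw P X K) {n : ℕ}
    (hn : ∀ T ∈ K, #T ≤ n) : ∀ᵐ ω ∂P, X ω ≤ n := by
  refine ae_of_ae_map (p := fun i => i ≤ n) hX.aemeasurable ?_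
  rw [hl.map_eq hX, ae_iff, Measure.finsetSum_apply]
  refine sum_eq_zero fun T hT => ?_
  simp [hn T hT]

lemma HasCountLaw.memLp (hX : Measurable X) (hl : HasCountLaw P X K) {n : ℕ}
    (hn : ∀ T ∈ K, #T ≤ n) (p : ENNReal) : MemLp (fun ω => (X ω : ℝ)) p P := by
  refine MemLp.of_bound (C := n) ?_ ?_
  · exact ((measurable_of_countable (fun i : ℕ => (i : ℝ))).comp hX).aestronglyMeasurable
  · filter_upwards [hl.ae_le hX hn] with ω hω
    simpa using hω

end CountLaw

end BinSeq

/-! ### Moments of the size of a random subset -/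

/-- 2#T - #s is a sum of #s signs, and a new element adds one more sign. This recursion drives the
first, second and exponential moments. -/
lemma sum_powerset_insert_centered {s : Finset ℕ} {a : ℕ} (ha : a ∉ s) (f : ℝ → ℝ) :
    ∑ T ∈ (insert a s).powerset, f (2 * #T - #(insert a s)) =
      ∑ T ∈ s.powerset, (f (2 * #T - #s - 1) + f (2 * #T - #s + 1)) := by
  rw [sum_powerset_insert ha, sum_add_distrib, card_insert_of_notMem ha]
  congr 1 <;> refine sum_congr rfl fun T hT => ?_
  · push_cast; ring_nf
  · rw [card_insert_of_notMem fun h => ha (mem_powerset.1 hT h)]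
    push_cast; ring_nf

lemma sum_powerset_centered (s : Finset ℕ) : ∑ T ∈ s.powerset, (2 * #T - #s : ℝ) = 0 := by
  induction s using Finset.induction with
  | empty => simp
  | insert a s ha ih =>
    rw [sum_powerset_insert_centered ha fun x => x]
    calc _ = ∑ T ∈ s.powerset, 2 * (2 * #T - #s : ℝ) := sum_congr rfl fun T _ => by ring
      _ = 0 := by rw [← mul_sum, ih, mul_zero]

lemma sum_powerset_centered_sq (s : Finset ℕ) :
    ∑ T ∈ s.powerset, (2 * #T - #s : ℝ) ^ 2 = 2 ^ #s * #s := by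
  induction s using Finset.induction with
  | empty => simp
  | insert a s ha ih =>
    rw [sum_powerset_insert_centered ha fun x => x ^ 2]
    calc _ = ∑ T ∈ s.powerset, (2 * (2 * #T - #s : ℝ) ^ 2 + 2) :=
          sum_congr rfl fun T _ => by ring
      _ = _ := by
        rw [sum_add_distrib, ← mul_sum, ih, sum_const, card_powerset, card_insert_of_notMem ha]
        simp
        ring

lemma sum_powerset_exp (s : Finset ℕ) (c : ℝ) :
    ∑ T ∈ s.powerset, Real.exp (c * (2 * #T - #s)) = (2 * Real.cosh c) ^ #s := by
  induction s using Finset.induction with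
  | empty => simp
  | insert a s ha ih =>
    rw [sum_powerset_insert_centered ha fun x => Real.exp (c * x)]
    calc _ = ∑ T ∈ s.powerset, (2 * Real.cosh c) * Real.exp (c * (2 * #T - #s)) := by
          refine sum_congr rfl fun T _ => ?_
          rw [Real.cosh_eq, mul_sub (c := (1 : ℝ)), mul_add (c := (1 : ℝ)), mul_one,
            sub_eq_add_neg _ c, Real.exp_add, Real.exp_add]
          ring
      _ = _ := by rw [← mul_sum, ih, card_insert_of_notMem ha]; ring

lemma abs_pow_le_factorial_mul_exp (k : ℕ) (x : ℝ) :
    |x| ^ k ≤ k.factorial * (Real.exp x + Real.exp (-x)) := by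
  have h1 := Real.pow_div_factorial_le_exp |x| (abs_nonneg x) k
  rw [div_le_iff₀ (by positivity)] at h1
  have h2 : Real.exp |x| ≤ Real.exp x + Real.exp (-x) := by
    rcases abs_cases x with ⟨e, -⟩ | ⟨e, -⟩ <;> rw [e]
    · linarith [Real.exp_pos (-x)]
    · linarith [Real.exp_pos x]
  calc |x| ^ k ≤ Real.exp |x| * k.factorial := h1
    _ ≤ _ := by rw [mul_comm]; gcongr

/-- Exponential moment bound: |x|^k ≤ k!(e^x + e^(-x)) at x = c(2#T - #s). The choice c = 1/√#s
keeps (cosh c)^#s ≤ exp(c²#s/2) = e^(1/2). -/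
lemma sum_powerset_abs_pow_le (s : Finset ℕ) (hs : s.Nonempty) (k : ℕ) :
    ∑ T ∈ s.powerset, |(2 * #T - #s : ℝ)| ^ k ≤
      2 ^ #s * (2 * k.factorial * Real.exp (1 / 2) * √(#s : ℝ) ^ k) := by
  have hn : (0 : ℝ) < #s := by exact_mod_cast hs.card_pos
  have hr : 0 < √(#s : ℝ) := Real.sqrt_pos.2 hn
  set c := 1 / √(#s : ℝ) with hc
  have hcosh : Real.cosh c ^ #s ≤ Real.exp (1 / 2) := by
    calc Real.cosh c ^ #s ≤ Real.exp (c ^ 2 / 2) ^ #s :=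
          pow_le_pow_left₀ (Real.cosh_pos c).le (Real.cosh_le_exp_half_sq c) _
      _ = Real.exp (1 / 2) := by
        rw [← Real.exp_nat_mul, hc, div_pow, Real.sq_sqrt hn.le]
        congr 1
        field_simp
  have hexp : ∀ d : ℝ, |d| = |c| → ∑ T ∈ s.powerset, Real.exp (d * (2 * #T - #s)) ≤
      2 ^ #s * Real.exp (1 / 2) := by
    intro d hd
    rw [sum_powerset_exp, mul_pow, ← Real.cosh_abs, hd, Real.cosh_abs]
    gcongr
  calc _ ≤ ∑ T ∈ s.powerset, √(#s : ℝ) ^ k * (k.factorial *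
        (Real.exp (c * (2 * #T - #s)) + Real.exp (-c * (2 * #T - #s)))) := by
        refine sum_le_sum fun T _ => ?_
        have := abs_pow_le_factorial_mul_exp k (c * (2 * #T - #s))
        rw [abs_mul, mul_pow, abs_of_pos (by positivity), hc, div_pow, one_pow, ← hc,
          ← neg_mul, one_div_mul_eq_div, div_le_iff₀ (by positivity)] at this
        linarith
    _ = √(#s : ℝ) ^ k * (k.factorial * (∑ T ∈ s.powerset, Real.exp (c * (2 * #T - #s)) +
        ∑ T ∈ s.powerset, Real.exp (-c * (2 * #T - #s)))) := by
        rw [← sum_add_distrib, mul_sum, mul_sum]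
    _ ≤ √(#s : ℝ) ^ k * (k.factorial * (2 ^ #s * Real.exp (1 / 2) + 2 ^ #s * Real.exp (1 / 2))) := by
        gcongr
        · exact hexp c rfl
        · exact hexp (-c) (abs_neg c)
    _ = _ := by ring

lemma abs_two_mul_card_sub_card_le {s T : Finset ℕ} (hT : T ∈ s.powerset) : |(2 * #T - #s : ℝ)| ≤ #s := by
  have : (#T : ℝ) ≤ #s := by exact_mod_cast card_le_card (mem_powerset.1 hT)
  have : (0 : ℝ) ≤ #T := by positivity
  rw [abs_le]
  constructor <;> linarith

/-- `K` is a nonempty family that lacks at most two of the subsets of `s`. -/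
structure IsNearlyFull (s : Finset ℕ) (K : Finset (Finset ℕ)) : Prop where
  subset : K ⊆ s.powerset
  nonempty : K.Nonempty
  card_le : 2 ^ #s ≤ #K + 2

/-! ### Moments over nearly full families -/

namespace IsNearlyFull

variable {s : Finset ℕ} {K : Finset (Finset ℕ)} (hK : IsNearlyFull s K)

include hK

lemma card_mem_le : ∀ T ∈ K, #T ≤ #s := fun _ hT => card_le_card (mem_powerset.1 (hK.subset hT))

lemma card_pos_real : (0 : ℝ) < #K := by exact_mod_cast hK.nonempty.card_pos

lemma card_le_two_pow : (#K : ℝ) ≤ 2 ^ #s := by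
  exact_mod_cast (card_le_card hK.subset).trans_eq (card_powerset s)

lemma two_pow_le (hs : s.Nonempty) : (2 : ℝ) ^ #s ≤ 2 * #K := by
  have h1 := hK.card_le
  have h2 := hK.nonempty.card_pos
  -- If #K = 1, the hypothesis only gives 2^#s ≤ 3; parity improves this to 2.
  have h3 : 2 ^ #s ≤ 2 * #K := by
    obtain ⟨n, hn⟩ : ∃ n, #s = n + 1 := ⟨_, (Nat.succ_pred_eq_of_pos hs.card_pos).symm⟩
    rw [hn, pow_succ] at h1 ⊢
    omega
  exact_mod_cast h3

lemma card_sdiff_le : (#(s.powerset \ K) : ℝ) ≤ 2 := by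
  have h1 := hK.card_le
  have h2 := card_sdiff_add_card_eq_card hK.subset
  rw [card_powerset] at h2
  exact_mod_cast (by omega : #(s.powerset \ K) ≤ 2)

lemma abs_sum_centered_le : |∑ T ∈ K, (2 * #T - #s : ℝ)| ≤ 2 * #s := by
  have h1 := sum_sdiff (f := fun T : Finset ℕ => (2 * #T - #s : ℝ)) hK.subset
  rw [sum_powerset_centered] at h1
  rw [eq_neg_of_add_eq_zero_right h1, abs_neg]
  refine (abs_sum_le_sum_abs _ _).trans ?_
  refine (sum_le_card_nsmul _ _ (#s : ℝ) fun T hT => abs_two_mul_card_sub_card_le (mem_sdiff.1 hT).1).trans ?_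
  rw [nsmul_eq_mul]
  gcongr
  exact hK.card_sdiff_le

lemma le_sum_centered_sq : (2 : ℝ) ^ #s * #s - 2 * #s ^ 2 ≤ ∑ T ∈ K, (2 * #T - #s : ℝ) ^ 2 := by
  have h1 := sum_sdiff (f := fun T : Finset ℕ => (2 * #T - #s : ℝ) ^ 2) hK.subset
  rw [sum_powerset_centered_sq] at h1
  have h2 : ∑ T ∈ s.powerset \ K, (2 * #T - #s : ℝ) ^ 2 ≤ 2 * #s ^ 2 := by
    refine (sum_le_card_nsmul _ _ ((#s : ℝ) ^ 2) fun T hT => ?_).trans ?_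
    · rw [← sq_abs]
      exact pow_le_pow_left₀ (abs_nonneg _) (abs_two_mul_card_sub_card_le (mem_sdiff.1 hT).1) 2
    · rw [nsmul_eq_mul]
      gcongr
      exact hK.card_sdiff_le
  linarith

/-- The full sum vanishes, the at most two missing subsets contribute at most #s each, and #K ≥ 2^#s
/ 2 ≥ #s. -/
lemma abs_mean_centered_le (hs : s.Nonempty) : |(∑ T ∈ K, (2 * #T - #s : ℝ)) / #K| ≤ 2 := by
  have h1 := hK.abs_sum_centered_le
  have h2 := hK.two_pow_le hs
  have h3 : (2 * #s : ℝ) ≤ 2 ^ #s := by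
    obtain ⟨n, hn⟩ : ∃ n, #s = n + 1 := ⟨_, (Nat.succ_pred_eq_of_pos hs.card_pos).symm⟩
    have : n + 1 ≤ 2 ^ n := Nat.lt_two_pow_self
    rw [hn, pow_succ, mul_comm]
    have : ((n + 1 : ℕ) : ℝ) ≤ 2 ^ n := by exact_mod_cast this
    linarith
  rw [abs_div, abs_of_pos hK.card_pos_real, div_le_iff₀ hK.card_pos_real]
  linarith

/-- The missing subsets cost at most 2(#s)² ≤ 4 · 2^#s out of #s · 2^#s when #s ≥ 4; otherwise the
left side is not positive. -/
lemma le_mean_centered_sq : (#s - 4 : ℝ) ≤ (∑ T ∈ K, (2 * #T - #s : ℝ) ^ 2) / #K := by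
  rw [le_div_iff₀ hK.card_pos_real]
  rcases le_total (#s : ℝ) 4 with h4 | h4
  · exact (mul_nonpos_of_nonpos_of_nonneg (by linarith) hK.card_pos_real.le).trans
      (sum_nonneg fun _ _ => sq_nonneg _)
  · have h1 := hK.le_sum_centered_sq
    have h2 : ∀ n : ℕ, 3 ≤ n → n ^ 2 ≤ 2 * 2 ^ n := by
      intro n hn
      induction n, hn using Nat.le_induction with
      | base => norm_num
      | succ n hn ih => rw [pow_succ 2 n]; nlinarith
    have h3 : (#s : ℝ) ^ 2 ≤ 2 * 2 ^ #s := by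
      have h4' : 4 ≤ #s := by exact_mod_cast h4
      exact_mod_cast h2 #s (by omega)
    calc (#s - 4 : ℝ) * #K ≤ (#s - 4) * 2 ^ #s :=
          mul_le_mul_of_nonneg_left hK.card_le_two_pow (by linarith)
      _ ≤ _ := by linarith

end IsNearlyFull

/-! ### Variance, central moments and Lyapunov's ratio -/

namespace BinSeq

section CountLaw

variable {Ω : Type*} [MeasurableSpace Ω] {P : Measure Ω} [IsProbabilityMeasure P] {X : Ω → ℕ}
  {s : Finset ℕ} {K : Finset (Finset ℕ)} (hK : IsNearlyFull s K) (hX : Measurable X)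
  (hl : HasCountLaw P X K)

include hK hX hl

lemma HasCountLaw.two_mul_mean_sub :
    2 * ∫ ω, (X ω : ℝ) ∂P - #s = (∑ T ∈ K, (2 * #T - #s : ℝ)) / #K := by
  have := hK.card_pos_real
  rw [hl.integral_eq hX fun i => (i : ℝ), sum_sub_distrib, ← mul_sum, sum_const, nsmul_eq_mul]
  field_simp

/-- With D = 2X - #s, the variance is (E D² - (E D)²)/4, where E D² ≥ #s - 4 and |E D| ≤ 2. -/
lemma HasCountLaw.le_variance (hs : s.Nonempty) :
    (#s / 4 - 2 : ℝ) ≤ Var[fun ω => (X ω : ℝ); P] := by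
  have hm := hl.two_mul_mean_sub hK hX
  have h1 := hK.abs_mean_centered_le hs
  have h2 := hK.le_mean_centered_sq
  have hp := hK.card_pos_real
  rw [variance_eq_integral (hl.memLp hX hK.card_mem_le 1).aestronglyMeasurable.aemeasurable,
    hl.integral_eq hX fun i => ((i : ℝ) - ∫ ω, (X ω : ℝ) ∂P) ^ 2]
  set μ := ∫ ω, (X ω : ℝ) ∂P
  set d := (∑ T ∈ K, (2 * #T - #s : ℝ)) / #K with hd
  have hd' : ∑ T ∈ K, (2 * #T - #s : ℝ) = d * #K := by rw [hd]; field_simp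
  have e : ∑ T ∈ K, ((#T : ℝ) - μ) ^ 2 =
      (∑ T ∈ K, (2 * #T - #s : ℝ) ^ 2 - #K * d ^ 2) / 4 := by
    have : ∀ T : Finset ℕ, ((#T : ℝ) - μ) ^ 2 =
        ((2 * #T - #s : ℝ) ^ 2 - 2 * d * (2 * #T - #s : ℝ) + d ^ 2) / 4 := by
      intro T
      have : μ = (d + #s) / 2 := by linarith
      rw [this]; ring
    simp_rw [this]
    rw [← sum_div, sum_add_distrib, sum_sub_distrib, ← mul_sum, hd', sum_const, nsmul_eq_mul]
    ring
  have e2 : (∑ T ∈ K, (2 * #T - #s : ℝ) ^ 2 - #K * d ^ 2) / 4 / #K =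
      ((∑ T ∈ K, (2 * #T - #s : ℝ) ^ 2) / #K - d ^ 2) / 4 := by
    rw [div_right_comm, sub_div, mul_div_cancel_left₀ _ hp.ne']
  rw [e, e2]
  have h3 : d ^ 2 ≤ 4 := by rw [← sq_abs]; nlinarith [abs_nonneg d]
  linarith

lemma HasCountLaw.central_moment_le (hs : s.Nonempty) (k : ℕ) :
    ∫ ω, |(X ω : ℝ) - ∫ ω', (X ω' : ℝ) ∂P| ^ k ∂P ≤
      (4 * k.factorial * Real.exp (1 / 2) + 2 ^ k) * √(#s : ℝ) ^ k := by
  have hm := hl.two_mul_mean_sub hK hX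
  have h1 := hK.abs_mean_centered_le hs
  have hp := hK.card_pos_real
  have hs1 : 1 ≤ √(#s : ℝ) := Real.one_le_sqrt.2 (by exact_mod_cast hs.card_pos)
  rw [hl.integral_eq hX fun i => |(i : ℝ) - ∫ ω, (X ω : ℝ) ∂P| ^ k, div_le_iff₀ hp]
  set μ := ∫ ω, (X ω : ℝ) ∂P
  rw [← hm] at h1
  have key : ∀ T : Finset ℕ, |(#T : ℝ) - μ| ^ k ≤ |(2 * #T - #s : ℝ)| ^ k + 2 ^ k := by
    intro T
    -- The deviation is at most the average of |2#T - #s| and 2, hence at most the larger of the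
    -- two.
    have h2 : |(#T : ℝ) - μ| ≤ (|(2 * #T - #s : ℝ)| + 2) / 2 := by
      have e : (#T : ℝ) - μ = ((2 * #T - #s) - (2 * μ - #s)) / 2 := by ring
      rw [e, abs_div, abs_two]
      gcongr
      exact (abs_sub _ _).trans (by gcongr)
    rcases le_total |(2 * #T - #s : ℝ)| 2 with h3 | h3
    · calc |(#T : ℝ) - μ| ^ k ≤ 2 ^ k := pow_le_pow_left₀ (abs_nonneg _) (by linarith) k
        _ ≤ _ := le_add_of_nonneg_left (by positivity)
    · calc |(#T : ℝ) - μ| ^ k ≤ |(2 * #T - #s : ℝ)| ^ k :=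
            pow_le_pow_left₀ (abs_nonneg _) (by linarith) k
        _ ≤ _ := le_add_of_nonneg_right (by positivity)
  calc _ ≤ ∑ T ∈ K, (|(2 * #T - #s : ℝ)| ^ k + 2 ^ k) := sum_le_sum fun T _ => key T
    _ = ∑ T ∈ K, |(2 * #T - #s : ℝ)| ^ k + #K * 2 ^ k := by
        rw [sum_add_distrib, sum_const, nsmul_eq_mul]
    _ ≤ 2 ^ #s * (2 * k.factorial * Real.exp (1 / 2) * √(#s : ℝ) ^ k) + #K * (2 ^ k * √(#s : ℝ) ^ k) := by
        gcongr
        · exact (sum_le_sum_of_subset_of_nonneg hK.subset fun _ _ _ => by positivity).trans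
            (sum_powerset_abs_pow_le s hs k)
        · exact le_mul_of_one_le_right (by positivity) (one_le_pow₀ hs1)
    _ ≤ 2 * #K * (2 * k.factorial * Real.exp (1 / 2) * √(#s : ℝ) ^ k) + #K * (2 ^ k * √(#s : ℝ) ^ k) := by
        gcongr
        exact hK.two_pow_le hs
    _ = _ := by ring

end CountLaw

section Rate

variable {Ω : Type*} [MeasurableSpace Ω] {P : Measure Ω} [IsProbabilityMeasure P]
  {Y : ℕ → Ω → ℕ} {s : ℕ → Finset ℕ} {K : ℕ → Finset (Finset ℕ)} {N : ℕ}
  (hs : ∀ n ∈ Icc 1 N, #(s n) = n) (hK : ∀ n ∈ Icc 1 N, IsNearlyFull (s n) (K n))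
  (hY : ∀ n, Measurable (Y n)) (hl : ∀ n ∈ Icc 1 N, HasCountLaw P (Y n) (K n))

include hs hK hY hl

/-- The lower bounds n/4 - 2 sum to N(N + 1)/8 - 2N, which is at least N²/16 once N ≥ 32. -/
lemma sq_le_sum_variance (hN : 32 ≤ N) :
    ((N : ℝ) / 4) ^ 2 ≤ ∑ n ∈ Icc 1 N, Var[fun ω => (Y n ω : ℝ); P] := by
  have e : ∀ M : ℕ, ∑ n ∈ Icc 1 M, ((n : ℝ) / 4 - 2) = M * (M + 1) / 8 - 2 * M := by
    intro M
    induction M with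
    | zero => simp
    | succ M ih => rw [sum_Icc_succ_top (by omega), ih]; push_cast; ring
  have h1 : ∑ n ∈ Icc 1 N, ((n : ℝ) / 4 - 2) ≤ ∑ n ∈ Icc 1 N, Var[fun ω => (Y n ω : ℝ); P] := by
    refine sum_le_sum fun n hn => ?_
    have hne : (s n).Nonempty := card_pos.1 (by rw [hs n hn]; exact (mem_Icc.1 hn).1)
    have := (hl n hn).le_variance (hK n hn) (hY n) hne
    rwa [hs n hn] at this
  rw [e] at h1
  have : (32 : ℝ) ≤ N := by exact_mod_cast hN
  nlinarith

/-- N moments of order at most N^(k/2) stand against s_N^k ≥ (N/4)^k, so the ratio is of order N^(1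
- k/2) ≤ N^(-1/2). -/
lemma lyapunov_ratio_le (hN : 32 ≤ N) {k : ℕ} (hk : 3 ≤ k) :
    (1 / √(∑ n ∈ Icc 1 N, Var[fun ω => (Y n ω : ℝ); P]) ^ k) *
      ∑ n ∈ Icc 1 N, ∫ ω, |(Y n ω : ℝ) - ∫ ω', (Y n ω' : ℝ) ∂P| ^ k ∂P ≤
      4 ^ k * (4 * k.factorial * Real.exp (1 / 2) + 2 ^ k) / √N := by
  set C : ℝ := 4 * k.factorial * Real.exp (1 / 2) + 2 ^ k with hC
  have hC0 : 0 < C := by positivity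
  have hN' : (0 : ℝ) < N := by exact_mod_cast (by omega : 0 < N)
  have hN1 : (1 : ℝ) ≤ N := by exact_mod_cast (by omega : 1 ≤ N)
  have hr : 1 ≤ √(N : ℝ) := Real.one_le_sqrt.2 hN1
  have h1 : (N : ℝ) / 4 ≤ √(∑ n ∈ Icc 1 N, Var[fun ω => (Y n ω : ℝ); P]) :=
    Real.le_sqrt_of_sq_le (sq_le_sum_variance hs hK hY hl hN)
  have h2 : ∑ n ∈ Icc 1 N, ∫ ω, |(Y n ω : ℝ) - ∫ ω', (Y n ω' : ℝ) ∂P| ^ k ∂P ≤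
      N * (C * √N ^ k) := by
    refine (sum_le_card_nsmul _ _ (C * √N ^ k) fun n hn => ?_).trans (by simp)
    have hne : (s n).Nonempty := card_pos.1 (by rw [hs n hn]; exact (mem_Icc.1 hn).1)
    have := (hl n hn).central_moment_le (hK n hn) (hY n) hne k
    rw [hs n hn] at this
    refine this.trans ?_
    gcongr
    exact (mem_Icc.1 hn).2
  calc _ ≤ (1 / ((N : ℝ) / 4) ^ k) * (N * (C * √N ^ k)) := by gcongr
    _ = 4 ^ k * C * (N / √N ^ k) := by
      have : (N : ℝ) ^ k = √N ^ k * √N ^ k := by rw [← mul_pow, Real.mul_self_sqrt hN'.le]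
      rw [div_pow, this]
      field_simp
    _ ≤ 4 ^ k * C * (1 / √N) := by
      refine mul_le_mul_of_nonneg_left ?_ (by positivity)
      rw [div_le_div_iff₀ (by positivity) (by positivity), one_mul]
      calc (N : ℝ) * √N = √N ^ 3 := by rw [pow_succ, Real.sq_sqrt hN'.le]
        _ ≤ √N ^ k := pow_le_pow_right₀ hr hk
    _ = _ := by ring

end Rate

end BinSeq

/-! ### Limit theorems for the counts -/

namespace BinSeq

/-- The central limit theorem for independent sizes of random members of nearly full families. -/
theorem tendstoInDistribution_sum_count {Ω : ℕ → Type*} {m : ∀ N, MeasurableSpace (Ω N)}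
    {P : ∀ N, Measure (Ω N)} [∀ N, IsProbabilityMeasure (P N)] {Y : ∀ N, ℕ → Ω N → ℕ} {M : ℕ → ℕ}
    (hM : Tendsto M atTop atTop) {s : ℕ → Finset ℕ} {K : ℕ → ℕ → Finset (Finset ℕ)}
    (hs : ∀ n, 1 ≤ n → #(s n) = n) (hK : ∀ N, ∀ n ∈ Icc 1 (M N), IsNearlyFull (s n) (K N n))
    (hY : ∀ N n, Measurable (Y N n))
    (hl : ∀ N, ∀ n ∈ Icc 1 (M N), HasCountLaw (P N) (Y N n) (K N n))
    (hind : ∀ N, iIndepFun (fun n : Icc 1 (M N) => Y N n) (P N)) :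
    TendstoInDistribution
      (fun N ω => (1 / √(∑ n ∈ Icc 1 (M N), Var[fun ω => (Y N n ω : ℝ); P N])) *
        ∑ n ∈ Icc 1 (M N), ((Y N n ω : ℝ) - ∫ ω', (Y N n ω' : ℝ) ∂P N))
      atTop (id : ℝ → ℝ) P (gaussianReal 0 1) := by
  have hs' : ∀ N, ∀ n ∈ Icc 1 (M N), #(s n) = n := fun N n hn => hs n (mem_Icc.1 hn).1
  have hlarge : ∀ᶠ N in atTop, 32 ≤ M N := hM.eventually_ge_atTop 32
  have key := tendstoInDistribution_sum_of_lyapunov (P := P) (ι := fun N => Icc 1 (M N))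
    (Y := fun N n ω => (Y N n ω : ℝ)) (fun N n => (hl N n n.2).memLp (hY N n) (hK N n n.2).card_mem_le 3)
    (fun N => (hind N).comp (fun _ i => (i : ℝ)) fun _ => measurable_of_countable _) ?_ ?_
  · convert key using 5 with N ω
    · congr 1
      exact (sum_coe_sort (Icc 1 (M N)) fun n => Var[fun ω => (Y N n ω : ℝ); P N]).symm
    · exact (sum_coe_sort (Icc 1 (M N)) fun n => (Y N n ω : ℝ) - ∫ ω', (Y N n ω' : ℝ) ∂P N).symm
  · filter_upwards [hlarge] with N hN
    rw [sum_coe_sort (Icc 1 (M N)) fun n => Var[fun ω => (Y N n ω : ℝ); P N]]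
    refine lt_of_lt_of_le ?_ (sq_le_sum_variance (hs' N) (hK N) (hY N) (hl N) hN)
    have : (0 : ℝ) < M N := by exact_mod_cast (by omega : 0 < M N)
    positivity
  · have hlim : Tendsto (fun N => 4 ^ 3 * (4 * (Nat.factorial 3) * Real.exp (1 / 2) + 2 ^ 3) /
        √(M N : ℝ)) atTop (𝓝 0) :=
      ((Real.tendsto_sqrt_atTop.comp tendsto_natCast_atTop_atTop).comp hM).const_div_atTop _
    refine squeeze_zero' (Eventually.of_forall fun N => ?_) ?_ hlim
    · exact mul_nonneg (by positivity) (sum_nonneg fun _ _ => integral_nonneg fun _ => by positivity)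
    · filter_upwards [hlarge] with N hN
      rw [sum_coe_sort (Icc 1 (M N)) fun n => Var[fun ω => (Y N n ω : ℝ); P N],
        sum_coe_sort (Icc 1 (M N)) fun n =>
          ∫ ω, |(Y N n ω : ℝ) - ∫ ω', (Y N n ω' : ℝ) ∂P N| ^ 3 ∂P N]
      exact lyapunov_ratio_le (hs' N) (hK N) (hY N) (hl N) hN le_rfl

theorem lyapunovCondition_count {Ω : Type*} [MeasurableSpace Ω] {P : Measure Ω}
    [IsProbabilityMeasure P] {Y : ℕ → Ω → ℕ} {s : ℕ → Finset ℕ} {K : ℕ → Finset (Finset ℕ)}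
    (hs : ∀ n, 1 ≤ n → #(s n) = n) (hK : ∀ n, 1 ≤ n → IsNearlyFull (s n) (K n))
    (hY : ∀ n, Measurable (Y n)) (hl : ∀ n, 1 ≤ n → HasCountLaw P (Y n) (K n))
    {δ : ℕ} (hδ : 0 < δ) : LyapunovCondition P (fun n ω => (Y n ω : ℝ)) δ := by
  refine ⟨fun n hn => (hl n hn).memLp (hY n) (hK n hn).card_mem_le _, ?_⟩
  have hlim : Tendsto (fun N : ℕ => 4 ^ (2 + δ) * (4 * (Nat.factorial (2 + δ)) * Real.exp (1 / 2) +
      2 ^ (2 + δ)) / √(N : ℝ)) atTop (𝓝 0) :=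
    (Real.tendsto_sqrt_atTop.comp tendsto_natCast_atTop_atTop).const_div_atTop _
  refine squeeze_zero' (Eventually.of_forall fun N => ?_) ?_ hlim
  · exact mul_nonneg (one_div_nonneg.2 (pow_nonneg (Real.sqrt_nonneg _) _))
      (sum_nonneg fun _ _ => integral_nonneg fun _ => by positivity)
  · filter_upwards [eventually_ge_atTop 32] with N hN
    exact lyapunov_ratio_le (fun n hn => hs n (mem_Icc.1 hn).1) (fun n hn => hK n (mem_Icc.1 hn).1)
      hY (fun n hn => hl n (mem_Icc.1 hn).1) hN (by omega)

/-! ### Integers whose largest summand is in a given bin -/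

variable {b : ℕ → ℕ} {A : ℕ → Finset ℕ}

open Classical in
/-- The choices allowed in each bin when bin `N` has to be used. -/
noncomputable def choicesUsing (b : ℕ → ℕ) (A : ℕ → Finset ℕ) (N : ℕ) : ℕ → Finset (Finset ℕ) :=
  fun n => {T ∈ choices b A n | n = N → T.Nonempty}

lemma choicesUsing_subset (N n : ℕ) : choicesUsing b A N n ⊆ choices b A n := filter_subset _ _

lemma restricted_choices_eq (N : ℕ) (h : IsLinear b A) :
    restricted b A (choices b A) N = range (totalChoices b A N) := by
  ext x
  rw [mem_restricted, mem_range, and_iff_left_iff_imp]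
  exact fun _ n hn => inter_bin_mem_choices (h.isDecomposition_decomp x).1 (mem_Icc.1 hn).1

namespace IsLinear

variable (h : IsLinear b A)

include h

lemma two_pow_le_card_choices (n : ℕ) : 2 ^ (n + 1) ≤ #(choices b A (n + 1)) + 1 := by
  rcases h.card_choices_eq n with ⟨-, e⟩ | ⟨-, e⟩ <;> rw [e]
  · exact Nat.le_succ _
  · exact Nat.sub_le_iff_le_add.1 le_rfl

lemma card_bin' {n : ℕ} (hn : 1 ≤ n) : #(bin b n) = n := by
  obtain ⟨n, rfl⟩ : ∃ m, n = m + 1 := ⟨n - 1, by omega⟩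
  exact h.card_bin n

lemma choices_nonempty {n : ℕ} (hn : 1 ≤ n) : (choices b A n).Nonempty := by
  obtain ⟨n, rfl⟩ : ∃ m, n = m + 1 := ⟨n - 1, by omega⟩
  exact card_pos.1 (h.card_choices_pos n)

lemma isNearlyFull_choices {n : ℕ} (hn : 1 ≤ n) : IsNearlyFull (bin b n) (choices b A n) := by
  refine ⟨filter_subset _ _, h.choices_nonempty hn, ?_⟩
  obtain ⟨n, rfl⟩ : ∃ m, n = m + 1 := ⟨n - 1, by omega⟩
  rw [h.card_bin]
  exact (h.two_pow_le_card_choices n).trans (Nat.le_succ _)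

/-- Only the full bin and, in bin `N`, the empty choice can be missing. `N ≥ 2` matters: if `A 1 =
{0}`, bin 1 has no nonempty choice. -/
lemma isNearlyFull_choicesUsing {N n : ℕ} (hN : 2 ≤ N) (hn : 1 ≤ n) :
    IsNearlyFull (bin b n) (choicesUsing b A N n) := by
  have hsub : (choices b A n).erase ∅ ⊆ choicesUsing b A N n := by
    intro T hT
    rw [mem_erase] at hT
    exact mem_filter.2 ⟨hT.2, fun _ => nonempty_iff_ne_empty.2 hT.1⟩
  have h1 := (card_le_card hsub).trans' pred_card_le_card_erase
  have h2 : 2 ^ n ≤ #(choices b A n) + 1 := by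
    obtain ⟨n, rfl⟩ : ∃ m, n = m + 1 := ⟨n - 1, by omega⟩
    exact h.two_pow_le_card_choices n
  refine ⟨(choicesUsing_subset N n).trans (filter_subset _ _), ?_, ?_⟩
  · by_cases hnN : n = N
    · have h3 : 2 ^ 2 ≤ 2 ^ n := Nat.pow_le_pow_right (by omega) (by omega)
      exact card_pos.1 (by omega)
    · obtain ⟨T, hT⟩ := h.choices_nonempty hn
      exact ⟨T, mem_filter.2 ⟨hT, fun e => absurd e hnN⟩⟩
  · rw [h.card_bin' hn]
    omega

lemma totalChoices_mono : Monotone (totalChoices b A) := by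
  refine monotone_nat_of_le_succ fun n => ?_
  rw [totalChoices_succ]
  exact Nat.le_mul_of_pos_right _ (h.card_choices_pos n)

lemma seq_le_totalChoices {n i : ℕ} (hi : i < n + 1) :
    seq b A 0 (binStart b (n + 1) + i) ≤ totalChoices b A (n + 1) := by
  rw [h.seq_eq hi, totalChoices_succ]
  refine Nat.mul_le_mul_left _ ?_
  have h1 : 2 ^ i ≤ 2 ^ n := Nat.pow_le_pow_right (by omega) (by omega)
  have h2 := h.two_pow_le_card_choices n
  have h3 : 1 ≤ 2 ^ n := Nat.one_le_two_pow
  rw [pow_succ] at h2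
  omega

/-- Strictness rules out ties with later bins. It can fail in bin 1: if `A 1 = {0}`, the first terms
of bins 1 and 2 are both 1. -/
lemma seq_lt_totalChoices {n i : ℕ} (hi : i < n + 1) (hn : 1 ≤ n) :
    seq b A 0 (binStart b (n + 1) + i) < totalChoices b A (n + 1) := by
  rw [h.seq_eq hi, totalChoices_succ]
  refine Nat.mul_lt_mul_of_pos_left ?_ (h.totalChoices_pos n)
  have h1 : 2 ^ i ≤ 2 ^ n := Nat.pow_le_pow_right (by omega) (by omega)
  have h2 := h.two_pow_le_card_choices n
  have h3 : 2 ^ 1 ≤ 2 ^ n := Nat.pow_le_pow_right (by omega) hn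
  rw [pow_succ] at h2
  omega

lemma totalChoices_le_seq {n i : ℕ} (hi : i < n + 1) :
    totalChoices b A n ≤ seq b A 0 (binStart b (n + 1) + i) := by
  rw [h.seq_eq hi]
  exact Nat.le_mul_of_pos_right _ (by positivity)

lemma seq_mono : Monotone (seq b A 0) := by
  intro j k hjk
  obtain ⟨m, i, hi, rfl⟩ := h.exists_position j
  obtain ⟨n, l, hl, rfl⟩ := h.exists_position k
  rcases lt_trichotomy m n with hmn | rfl | hmn
  · exact (h.seq_le_totalChoices hi).trans ((h.totalChoices_mono hmn).trans
      (h.totalChoices_le_seq hl))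
  · rw [h.seq_eq hi, h.seq_eq hl]
    exact Nat.mul_le_mul_left _ (Nat.pow_le_pow_right (by omega) (by omega))
  · have : binStart b (n + 2) ≤ binStart b (m + 1) := binStart_mono (by omega)
    rw [h.binStart_succ] at this
    omega

lemma largestInBin_eq {N : ℕ} (hN : 2 ≤ N) :
    largestInBin b A 0 N = ↑(restricted b A (choicesUsing b A N) N) := by
  obtain ⟨N, rfl⟩ : ∃ m, N = m + 1 := ⟨N - 1, by omega⟩
  ext x
  have hleg := (h.isDecomposition_decomp x).1
  rw [mem_coe, mem_restricted, ← h.decomp_subset_iff]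
  constructor
  · rintro ⟨i, hi, hiN, hmax⟩
    refine ⟨fun j hj => ?_, fun n hn => mem_filter.2
      ⟨inter_bin_mem_choices hleg (mem_Icc.1 hn).1, ?_⟩⟩
    · obtain ⟨l, hl, rfl⟩ := h.mem_bin_iff.1 hiN
      have h1 := hmax j hj
      obtain ⟨m, k, hk, rfl⟩ := h.exists_position j
      have h2 := h.seq_lt_totalChoices hl (by omega)
      have h3 := h.totalChoices_le_seq hk
      rw [mem_range]
      -- A summand from a later bin is at least M_(N+1), which exceeds every term of bin `N + 1`.
      by_contra! hc
      have hm : N + 1 ≤ m := by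
        by_contra! hm
        have : binStart b (m + 2) ≤ binStart b (N + 1 + 1) := binStart_mono (by omega)
        rw [h.binStart_succ] at this
        omega
      have := h.totalChoices_mono hm
      omega
    · rintro rfl
      exact ⟨i, mem_inter.2 ⟨hi, hiN⟩⟩
  · rintro ⟨hsub, hK⟩
    obtain ⟨i, hi⟩ := (mem_filter.1 (hK (N + 1) (mem_Icc.2 ⟨by omega, le_rfl⟩))).2 rfl
    rw [mem_inter] at hi
    have hne : (decomp b A 0 x).Nonempty := ⟨i, hi.1⟩
    refine ⟨(decomp b A 0 x).max' hne, max'_mem _ _, ?_, fun j hj => h.seq_mono (le_max' _ _ hj)⟩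
    have h1 := le_max' _ _ hi.1
    have h2 := mem_range.1 (hsub (max'_mem _ hne))
    have h3 := hi.2
    rw [bin, mem_Ico] at h3 ⊢
    omega

lemma numSummands_eq_sum {x N : ℕ} (hx : x < totalChoices b A N) :
    numSummands b A 0 x = ∑ n ∈ Icc 1 N, binCount b A 0 n x := by
  have hsub := h.decomp_subset_iff.2 hx
  simp only [numSummands, binCount]
  rw [← card_biUnion fun m _ n _ hmn =>
    (bin_disjoint hmn).mono inter_subset_right inter_subset_right]
  congr 1
  ext k
  simp only [mem_biUnion, mem_inter]
  refine ⟨fun hk => ?_, fun ⟨_, _, hk, _⟩ => hk⟩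
  obtain ⟨n, i, hi, rfl⟩ := h.exists_position k
  refine ⟨n + 1, mem_Icc.2 ⟨by omega, ?_⟩, hk, h.mem_bin_iff.2 ⟨i, hi, rfl⟩⟩
  by_contra! hc
  have h1 := mem_range.1 (hsub hk)
  have : binStart b (N + 1) ≤ binStart b (n + 1) := binStart_mono (by omega)
  omega

lemma tendsto_numSummands (t : ℝ) :
    Tendsto (fun N : ℕ =>
      (uniformOn (largestInBin b A 0 N)).real
        {x | ((numSummands b A 0 x : ℝ)
              - ∫ x', (numSummands b A 0 x' : ℝ) ∂(uniformOn (largestInBin b A 0 N)))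
            / √(Var[fun x' => (numSummands b A 0 x' : ℝ);
                uniformOn (largestInBin b A 0 N)]) ≤ t})
      atTop (𝓝 (cdf (gaussianReal 0 1) t)) := by
  -- The shift ensures that the bin number is at least 2, as `largestInBin_eq` requires.
  rw [← tendsto_add_atTop_iff_nat 2]
  set P : ℕ → Measure ℕ := fun N =>
    uniformOn (restricted b A (choicesUsing b A (N + 2)) (N + 2) : Set ℕ) with hP
  have hsub : ∀ N, ∀ n ∈ Icc 1 (N + 2), choicesUsing b A (N + 2) n ⊆ choices b A n :=
    fun N n _ => choicesUsing_subset _ n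
  have hfull : ∀ N, ∀ n ∈ Icc 1 (N + 2), IsNearlyFull (bin b n) (choicesUsing b A (N + 2) n) :=
    fun N n hn => h.isNearlyFull_choicesUsing (by omega) (mem_Icc.1 hn).1
  have hne : ∀ N, ∀ n ∈ Icc 1 (N + 2), (choicesUsing b A (N + 2) n).Nonempty :=
    fun N n hn => (hfull N n hn).nonempty
  have hprob : ∀ N, IsProbabilityMeasure (P N) := fun N =>
    isProbabilityMeasure_uniformOn_restricted h (hsub N) (hne N)
  have hlaw : ∀ N, ∀ n ∈ Icc 1 (N + 2),
      HasCountLaw (P N) (binCount b A 0 n) (choicesUsing b A (N + 2) n) :=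
    fun N n hn => hasCountLaw_binCount h (hsub N) (hne N) hn
  have hind : ∀ N, iIndepFun (fun n : Icc 1 (N + 2) => binCount b A 0 n) (P N) := fun N =>
    iIndepFun_binCount h (hsub N) (hne N)
  have hmemLp : ∀ N, ∀ n ∈ Icc 1 (N + 2), MemLp (fun x => (binCount b A 0 n x : ℝ)) 2 (P N) :=
    fun N n hn => (hlaw N n hn).memLp (measurable_of_countable _) (hfull N n hn).card_mem_le 2
  -- Equality holds only on the support: other integers may have summands in later bins.
  have hsum : ∀ N, (fun x => (numSummands b A 0 x : ℝ)) =ᵐ[P N]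
      fun x => ∑ n ∈ Icc 1 (N + 2), (binCount b A 0 n x : ℝ) := by
    intro N
    have hmem : ∀ᵐ x ∂P N, x ∈ (restricted b A (choicesUsing b A (N + 2)) (N + 2) : Set ℕ) :=
      ae_cond_mem (finite_toSet _).measurableSet
    filter_upwards [hmem] with x hx
    rw [h.numSummands_eq_sum (mem_restricted.1 hx).1]
    push_cast
    rfl
  have hmean : ∀ N, ∫ x, (numSummands b A 0 x : ℝ) ∂P N =
      ∑ n ∈ Icc 1 (N + 2), ∫ x, (binCount b A 0 n x : ℝ) ∂P N := by
    intro N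
    rw [integral_congr_ae (hsum N), integral_finsetSum _ fun n hn =>
      (hmemLp N n hn).integrable (by norm_num)]
  have hvar : ∀ N, Var[fun x => (numSummands b A 0 x : ℝ); P N] =
      ∑ n ∈ Icc 1 (N + 2), Var[fun x => (binCount b A 0 n x : ℝ); P N] := by
    intro N
    rw [variance_congr (hsum N)]
    have := IndepFun.variance_sum (μ := P N) (s := Icc 1 (N + 2))
      (X := fun n x => (binCount b A 0 n x : ℝ)) (fun n hn => hmemLp N n hn) ?_
    · rw [← this]
      congr 1
      ext x
      simp
    · intro m hm n hn hmn
      exact ((hind N).indepFun (i := ⟨m, hm⟩) (j := ⟨n, hn⟩) (by simpa using hmn)).comp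
        (φ := fun i : ℕ => (i : ℝ)) (ψ := fun i : ℕ => (i : ℝ)) (measurable_of_countable _)
        (measurable_of_countable _)
  have key := tendsto_measureReal_le_of_tendstoInDistribution_gaussian
    (tendstoInDistribution_sum_count (P := P) (Y := fun _ => binCount b A 0) (M := fun N => N + 2)
      (tendsto_add_atTop_nat 2) (s := bin b) (K := fun N => choicesUsing b A (N + 2))
      (fun n hn => h.card_bin' hn) hfull (fun _ _ => measurable_of_countable _) hlaw hind) t
  refine key.congr fun N => ?_
  rw [h.largestInBin_eq (by omega)]
  change (P N).real _ = (P N).real {x | ((numSummands b A 0 x : ℝ)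
    - ∫ x', (numSummands b A 0 x' : ℝ) ∂P N) / √(Var[fun x' => (numSummands b A 0 x' : ℝ); P N]) ≤ t}
  refine measureReal_congr ?_
  filter_upwards [hsum N] with x hx
  rw [eq_iff_iff]
  change _ ≤ t ↔ _ ≤ t
  rw [hx, hmean, hvar, sum_sub_distrib, one_div_mul_eq_div]

end IsLinear

end BinSeq

/-! ### The main theorem -/

theorem theorem1p4 (b : ℕ → ℕ) (A : ℕ → Finset ℕ)
    (hb : ∀ n, 1 ≤ n → b n = n)
    (hA : ∀ n, 1 ≤ n → A n = Finset.range n ∨ A n = Finset.range (n + 1)) :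
    -- every positive integer has exactly one legal decomposition
    (∀ x : ℕ, 0 < x → ∃! S, BinSeq.IsDecomposition b A 0 S x) ∧
    -- for a uniformly random integer generated by the bins `1, …, N`, the numbers of summands from
    -- these bins are independent, each with the law of the size of a uniform choice from its bin
    (∀ (N : ℕ) (y : ℕ → ℕ),
      (uniformOn (BinSeq.generatedBy b A 0 N)).real
        {x | ∀ n ∈ Finset.Icc 1 N, BinSeq.binCount b A 0 n x = y n} =
      ∏ n ∈ Finset.Icc 1 N, BinSeq.countProb b A n (y n)) ∧
    -- a sequence of independent random variables with these laws
    (∀ (Ω : Type*) [MeasurableSpace Ω] (P : Measure Ω) [IsProbabilityMeasure P] (Y : ℕ → Ω → ℕ),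
      (∀ n, Measurable (Y n)) →
      iIndepFun (fun n : ℕ => Y (n + 1)) P →
      (∀ n, 1 ≤ n → ∀ i : ℕ, P.real {ω | Y n ω = i} = BinSeq.countProb b A n i) →
      (∀ δ : ℕ, 0 < δ → BinSeq.LyapunovCondition P (fun n ω => (Y n ω : ℝ)) δ) ∧
      TendstoInDistribution
        (fun (N : ℕ) (ω : Ω) => (1 / BinSeq.sd P (fun n ω => (Y n ω : ℝ)) N) *
          ∑ n ∈ Finset.Icc 1 N, ((Y n ω : ℝ) - ∫ ω', (Y n ω' : ℝ) ∂P))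
        atTop (id : ℝ → ℝ) (fun _ => P) (gaussianReal 0 1)) ∧
    -- the number of summands of a uniformly random integer whose largest summand is in bin `N`
    (∀ t : ℝ,
      Tendsto (fun N : ℕ =>
        (uniformOn (BinSeq.largestInBin b A 0 N)).real
          {x | ((BinSeq.numSummands b A 0 x : ℝ)
                - ∫ x', (BinSeq.numSummands b A 0 x' : ℝ) ∂(uniformOn (BinSeq.largestInBin b A 0 N)))
              / √(Var[fun x' => (BinSeq.numSummands b A 0 x' : ℝ);
                  uniformOn (BinSeq.largestInBin b A 0 N)]) ≤ t})
        atTop (𝓝 (cdf (gaussianReal 0 1) t))) := by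
  have h : BinSeq.IsLinear b A := ⟨hb, hA⟩
  refine ⟨fun x _ => h.existsUnique_isDecomposition x, fun N y => ?_, ?_, h.tendsto_numSummands⟩
  · rw [h.generatedBy_eq, ← BinSeq.restricted_choices_eq N h]
    exact BinSeq.uniformOn_restricted_real h (fun n _ => Subset.rfl) fun n T => #T = y n
  · intro Ω _ P _ Y hY hind hl
    refine ⟨fun δ hδ => BinSeq.lyapunovCondition_count (fun n hn => h.card_bin' hn)
      (fun n hn => h.isNearlyFull_choices hn) hY hl hδ, ?_⟩
    refine BinSeq.tendstoInDistribution_sum_count (P := fun _ => P) (Y := fun _ => Y) (M := id)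
      tendsto_id (s := BinSeq.bin b) (K := fun _ => BinSeq.choices b A)
      (fun n hn => h.card_bin' hn) (fun N n hn => h.isNearlyFull_choices (mem_Icc.1 hn).1)
      (fun _ => hY) (fun N n hn => hl n (mem_Icc.1 hn).1) fun N => ?_
    -- `hind` lists Y_1, Y_2, … from index 0, so bin `n` has index `n - 1`; injectivity uses `n ≥
    -- 1`.
    have hinj : Function.Injective fun n : Icc 1 N => (n : ℕ) - 1 := by
      intro m n hmn
      have h1 := (mem_Icc.1 m.2).1
      have h2 := (mem_Icc.1 n.2).1
      simp only at hmn
      exact Subtype.ext (by omega)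
    have e : (fun n : Icc 1 N => Y n) = fun n : Icc 1 N => Y (n - 1 + 1) :=
      funext fun n => by rw [Nat.sub_add_cancel (mem_Icc.1 n.2).1]
    change iIndepFun (fun n : Icc 1 N => Y n) P
    rw [e]
    exact hind.precomp hinj
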